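/- Let $n\ge 1$, and let $\mathbb{R}^{n+1}$ carry its standard flat connection $D$ and volume form $\Psi=dx^1\wedge\dots\wedge dx^{n+1}$. For a smooth function $F$ write $F_i=\partial_iF$, $F_{ij}=\partial_i\partial_jF$, $\mathcal H(F)=\det(F_{ij})$ and $\mathcal U(F)=U^{ij}F_iF_j$, where $U^{ij}$ is the adjugate of $F_{ij}$; where $\mathcal H(F)\ne 0$ put $F^i=g^{ij}F_j$, where $g^{ij}$ is the inverse of $F_{ij}$. Affine spheres. The equiaffine normal of a co-oriented nondegenerate smooth hypersurface $M$ is the transverse field $\xi$ along $M$, on the side given by the co-orientation, such that for $X,Y$ tangent to $M$ one has $D_XY=\nabla_XY+h(X,Y)\xi$ and $D_X\xi=-S(X)$ with $\nabla_XY$, $S(X)$ tangent to $M$, $h$ nondegenerate, and $|\det h(X_i,X_j)|=\Psi(\xi,X_1,\dots,X_n)^2$ for tangent $X_1,\dots,X_n$. Here $h$ is the equiaffine metric, and $\tfrac1n\operatorname{tr}S$ is the affine mean curvature. A co-oriented, possibly disconnected, $M$ is a proper affine sphere with centre $v$ if it is nondegenerate, all its equiaffine normal lines pass through $v$, its affine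 mean curvature is a nonzero constant (the same on all components), and the signatures modulo $4$ of $h$ on the components all agree. It is an improper affine sphere with equiaffine normal $cv$ if it is nondegenerate, $\xi=cv$ with a constant $c$ (the same on all components), its affine mean curvature is $0$, and the signatures modulo $4$ of $h$ on the components all agree. Theorem. Let $\epsilon\in\{0,1\}$ and let $\alpha,\lambda\in\mathbb{R}$ be not both $0$, with $\alpha\lambda=0$, $\alpha\epsilon=0$ and $\lambda\neq 1-\epsilon$. Let $\Omega\subset\mathbb{R}^{n+1}$ be nonempty and open, and let $I\subset\mathbb{R}$ be a nonempty open interval such that $\lambda r+\alpha\ne0$ for all $r\in I$. Let $v\in\mathbb{R}^{n+1}$, and let $F$ be continuous on $\Omega$, smooth on $\Omega\setminus\{F=-\alpha/\lambda\}$ (on all of $\Omega$ if $\lambda=0$), and such that $$F\big((1-\epsilon)(e^t(x-v)+v)+\epsilon(x+tv)\big)=e^{\lambda t}F(x)+\alpha t$$ whenever $t\in\mathbb{R}$ and both $x$ and $(1-\epsilon)(e^t(x-v)+v)+\epsilon(x+tv)$ are in $\Omega$. Let $\Omega_I=\Omega\cap F^{-1}(I)$ and $L_r=\{x\in\Omega: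 F(x)=r\}$. The following conditions are equivalent: 1. there is a nonvanishing function $\phi:I\to\mathbb{R}$ such that $\mathcal H(F)=\phi(F)$ on $\Omega_I$; 2. there is a nonvanishing function $\psi:I\to\mathbb{R}$ such that $\mathcal U(F)=\psi(F)$ on $\Omega_I$; 3. (if $\epsilon=0$) for every $r\in I$ the level set $L_r$, with its components co-oriented by $-\operatorname{sign}(\mathcal U(F)\mathcal H(F))F^i$, is a proper affine sphere with centre $v$; 4. (if $\epsilon=1$) for every $r\in I$ the level set $L_r$, with its components co-oriented by $-\operatorname{sign}(\mathcal U(F)\mathcal H(F))F^i$, is an improper affine sphere with equiaffine normal $cv$ for a constant $c$ that depends only on $r$. (In 3 and 4 an empty level set satisfies the condition trivially.) When these conditions hold and the set of values $F(\Omega_I)$ is connected (for instance if $\Omega$ is connected, or if $I\subset F(\Omega)$), there is a constant $B\neq0$ such that for all $r\in F(\Omega_I)$: - if $\alpha=0$, $\epsilon=0$: $\phi(r)=B|r|^{(n+1)(\lambda-2)/\lambda}$, $\psi(r)=\frac{\lambda}{\lambda-1}r\phi(r)$, and $L_r$ has affine mean curvature $$\operatorname{sign}(\lambda r)\,|\lambda-1|^{-\frac1{n+2}}\,|\lambda|^{-\frac{n+1}{n+2}}\,|B|^{\frac1{n+2}}\,|r|^{\frac{(n+1)(\lambda-2)}{(n+2)\lambda}-\frac{n+1}{n+2}};$$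 - if $\lambda=0$, $\epsilon=0$: $\phi(r)=Be^{-2(n+1)r/\alpha}$, $\psi(r)=-\alpha\phi(r)$, and $L_r$ has affine mean curvature $$\operatorname{sign}(\alpha)\,|\alpha|^{-\frac{n+1}{n+2}}\,|B|^{\frac1{n+2}}\,e^{-\frac{2(n+1)r}{\alpha(n+2)}};$$ - if $\alpha=0$, $\epsilon=1$: $\phi(r)=Br^{n+1}$, $\psi(r)=r\phi(r)$, and $L_r$ has affine mean curvature $0$. -/

import Mathlib

open scoped ContDiff Topology

noncomputable section

namespace AffineSphere

/-- The Hessian matrix `F_{ij}` of `F` at `x` in the standard (equiaffine) coordinates. -/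
def hess {n : ℕ} (F : (Fin (n + 1) → ℝ) → ℝ) (x : Fin (n + 1) → ℝ) :
    Matrix (Fin (n + 1)) (Fin (n + 1)) ℝ :=
  Matrix.of fun i j => fderiv ℝ (fderiv ℝ F) x (Pi.single i 1) (Pi.single j 1)

/-- The components `F_i` of the differential of `F` at `x`. -/
def diff {n : ℕ} (F : (Fin (n + 1) → ℝ) → ℝ) (x : Fin (n + 1) → ℝ) : Fin (n + 1) → ℝ :=
  fun i => fderiv ℝ F x (Pi.single i 1)

/-- The Hessian determinant `H(F)`. -/
def hessDet {n : ℕ} (F : (Fin (n + 1) → ℝ) → ℝ) (x : Fin (n + 1) → ℝ) : ℝ :=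
  (hess F x).det

/-- `U(F) = U^{ij} F_i F_j`, where `U^{ij}` is the adjugate of the Hessian. -/
def adjQuad {n : ℕ} (F : (Fin (n + 1) → ℝ) → ℝ) (x : Fin (n + 1) → ℝ) : ℝ :=
  diff F x ⬝ᵥ ((hess F x).adjugate.mulVec (diff F x))

/-- The vector field `F^i = g^{ij} F_j`, where `g^{ij}` is the inverse of the Hessian
(meaningful where `hessDet F` does not vanish). -/
def hessGrad {n : ℕ} (F : (Fin (n + 1) → ℝ) → ℝ) (x : Fin (n + 1) → ℝ) : Fin (n + 1) → ℝ :=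
  (hess F x)⁻¹.mulVec (diff F x)

/-- The vector field `-sign(U(F) H(F)) F^i`, which defines the standard co-orientation of the
level sets of `F`. -/
def stdCoorient {n : ℕ} (F : (Fin (n + 1) → ℝ) → ℝ) (x : Fin (n + 1) → ℝ) : Fin (n + 1) → ℝ :=
  (-Real.sign (adjQuad F x * hessDet F x)) • hessGrad F x

/-- `F` is continuous on `Ω`, smooth on `Ω` away from the level set `F = -α/λ` (nothing is removed
if `λ = 0`), and affinely homogeneous with centre (`ε = 0`) or axial centre (`ε = 1`) `v`. -/
structure IsAffinelyHomogeneous {n : ℕ} (lam ε α : ℝ) (Ω : Set (Fin (n + 1) → ℝ))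
    (v : Fin (n + 1) → ℝ) (F : (Fin (n + 1) → ℝ) → ℝ) : Prop where
  continuousOn : ContinuousOn F Ω
  smoothOn : ContDiffOn ℝ ∞ F (Ω \ {x | lam ≠ 0 ∧ F x = -α / lam})
  homogeneous : ∀ (t : ℝ), ∀ x ∈ Ω,
    (1 - ε) • (Real.exp t • (x - v) + v) + ε • (x + t • v) ∈ Ω →
      F ((1 - ε) • (Real.exp t • (x - v) + v) + ε • (x + t • v)) =
        Real.exp (lam * t) * F x + α * t

/-- `M` is a smooth embedded hypersurface: locally the zero set of a smooth function with
nonvanishing differential. -/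
def IsSmoothHypersurface {n : ℕ} (M : Set (Fin (n + 1) → ℝ)) : Prop :=
  ∀ x ∈ M, ∃ (W : Set (Fin (n + 1) → ℝ)) (G : (Fin (n + 1) → ℝ) → ℝ),
    IsOpen W ∧ x ∈ W ∧ ContDiffOn ℝ ∞ G W ∧ (∀ y ∈ W, fderiv ℝ G y ≠ 0) ∧
      M ∩ W = {y ∈ W | G y = 0}

/-- The tangent space of `M` at `x`: the span of the velocities at `x` of curves in `M`. -/
def tangent {n : ℕ} (M : Set (Fin (n + 1) → ℝ)) (x : Fin (n + 1) → ℝ) :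
    Submodule ℝ (Fin (n + 1) → ℝ) :=
  Submodule.span ℝ {X | ∃ γ : ℝ → (Fin (n + 1) → ℝ),
    γ 0 = x ∧ (∀ᶠ t in 𝓝 0, γ t ∈ M) ∧ HasDerivAt γ X 0}

/-- `ξ` is (along `M`) the equiaffine normal field of the hypersurface `M` for the co-orientation
given by the vector field `κ`; `h` is the equiaffine metric, and `S` is the equiaffine shape
operator. The ambient volume form is the standard one (the determinant). -/
structure IsEquiaffine {n : ℕ} (M : Set (Fin (n + 1) → ℝ))
    (κ ξ : (Fin (n + 1) → ℝ) → (Fin (n + 1) → ℝ))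
    (h : ∀ x, LinearMap.BilinForm ℝ (tangent M x))
    (S : ∀ x, tangent M x →ₗ[ℝ] tangent M x) : Prop where
  hypersurface : IsSmoothHypersurface M
  /-- `ξ` is smooth in a neighbourhood of `M`. -/
  smooth : ∃ W, IsOpen W ∧ M ⊆ W ∧ ContDiffOn ℝ ∞ ξ W
  transverse : ∀ x ∈ M, ξ x ∉ tangent M x
  /-- `ξ` and `κ` point to the same side of `M`. -/
  cooriented : ∀ x ∈ M, ∃ c : ℝ, 0 < c ∧ ξ x - c • κ x ∈ tangent M x
  /-- Gauss formula `D_X Y = ∇_X Y + h(X, Y) ξ` with `∇_X Y` tangent to `M`, for `Y` a local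
  vector field tangent to `M`. -/
  gauss : ∀ x ∈ M, ∀ (X : tangent M x) (Y : (Fin (n + 1) → ℝ) → (Fin (n + 1) → ℝ)),
    ContDiffAt ℝ ∞ Y x → (∀ᶠ y in 𝓝[M] x, Y y ∈ tangent M y) → ∀ hY : Y x ∈ tangent M x,
      fderiv ℝ Y x X - h x X ⟨Y x, hY⟩ • ξ x ∈ tangent M x
  /-- Weingarten formula `D_X ξ = -S X + τ(X) ξ` with vanishing connection form `τ`. -/
  weingarten : ∀ x ∈ M, ∀ X : tangent M x, fderiv ℝ ξ x X = -(S x X : Fin (n + 1) → ℝ)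
  nondegenerate : ∀ x ∈ M, (h x).Nondegenerate
  /-- The volume density of `h` is the one induced by `ξ` and the determinant. -/
  volume : ∀ x ∈ M, ∀ X : Fin n → tangent M x,
    |(Matrix.of fun i j => h x (X i) (X j)).det| =
      (Matrix.of (Matrix.vecCons (ξ x) fun i => (X i : Fin (n + 1) → ℝ))).det ^ 2

/-- Number of positive minus number of negative eigenvalues of a symmetric bilinear form. -/
def signature {V : Type*} [AddCommGroup V] [Module ℝ V] (h : LinearMap.BilinForm ℝ V) : ℤ :=
  sigPos (LinearMap.BilinMap.toQuadraticMap h) -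
    sigNeg (LinearMap.BilinMap.toQuadraticMap h)

/-- The shape operator field `S` on `M` has constant mean curvature (normalized trace) `A`. -/
def HasMeanCurvature {n : ℕ} (M : Set (Fin (n + 1) → ℝ))
    (S : ∀ x, tangent M x →ₗ[ℝ] tangent M x) (A : ℝ) : Prop :=
  ∀ x ∈ M, LinearMap.trace ℝ (tangent M x) (S x) / n = A

/-- The co-oriented, possibly disconnected, nondegenerate hypersurface `M` has constant affine mean
curvature `A`. -/
def HasAffineMeanCurvature {n : ℕ} (M : Set (Fin (n + 1) → ℝ))
    (κ : (Fin (n + 1) → ℝ) → (Fin (n + 1) → ℝ)) (A : ℝ) : Prop :=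
  ∃ ξ h S, IsEquiaffine M κ ξ h S ∧ HasMeanCurvature M S A

/-- `M`, with the co-orientation of its components given by `κ`, is a (possibly disconnected) proper
affine sphere with centre `v`: it is nondegenerate, all equiaffine normal lines pass through `v`,
the affine mean curvature is the same nonzero constant on all components, and the signatures modulo
4 of the equiaffine metric are the same on all components. -/
def IsProperAffineSphere {n : ℕ} (M : Set (Fin (n + 1) → ℝ))
    (κ : (Fin (n + 1) → ℝ) → (Fin (n + 1) → ℝ)) (v : Fin (n + 1) → ℝ) : Prop :=
  ∃ ξ h S, IsEquiaffine M κ ξ h S ∧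
    (∀ x ∈ M, ∃ s : ℝ, v = x + s • ξ x) ∧
    (∃ A : ℝ, A ≠ 0 ∧ HasMeanCurvature M S A) ∧
    ∀ x ∈ M, ∀ y ∈ M, signature (h x) ≡ signature (h y) [ZMOD 4]

/-- `M`, with the co-orientation of its components given by `κ`, is a (possibly disconnected)
improper affine sphere whose equiaffine normal is `c v` for a constant `c` (the same on all
components). -/
def IsImproperAffineSphere {n : ℕ} (M : Set (Fin (n + 1) → ℝ))
    (κ : (Fin (n + 1) → ℝ) → (Fin (n + 1) → ℝ)) (v : Fin (n + 1) → ℝ) : Prop :=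
  ∃ ξ h S, IsEquiaffine M κ ξ h S ∧
    (∃ c : ℝ, ∀ x ∈ M, ξ x = c • v) ∧
    HasMeanCurvature M S 0 ∧
    ∀ x ∈ M, ∀ y ∈ M, signature (h x) ≡ signature (h y) [ZMOD 4]

end AffineSphere

end

noncomputable section

namespace AffineSphere

/-! Let `E` be the generator of the flow, `μ = lam - (1 - ε)` and `d = lam * r + α`. Differentiating
homogeneity at `t = 0` gives Euler's identity `dF(E) = lam * F + α`, and differentiating once more
gives `Hess F (E, ·) = μ dF`. So `E` is transverse to the level sets in question and
Hessian-orthogonal to their tangent spaces. Contraction with the adjugate gives `μ U(F) = (lam * F +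
α) H(F)`, hence the equivalence of the first two conditions (`mul_adjQuad`).

On `L_r` the Hessian determinant splits off the `E` direction: `μ d` times the Gram determinant of
the tangential Hessian equals `H(F) det(E, X)²` (`gram_det`). If a constant multiple `k E` is the
equiaffine normal, its metric is the tangential Hessian divided by `-k d`, and the volume condition
becomes `|k|^(n+2) |μ| |d|^(n+1) = |H(F)|`. Thus constancy of `H(F)` on `L_r` produces an affine
sphere (`isEquiaffine_levelSet`), and an affine sphere makes `|H(F)|` constant
(`hessDet_eq_of_isEquiaffine`). The sign of `H(F)` can differ between components; it is encoded in
the signature modulo 4 (`signature_modEq_four`), which is why that condition is part of the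
definition. For proper spheres, `normal_eq_of_isEquiaffine` shows that the factor `k` is minus the
mean curvature.

The explicit formulas follow because `H(F)` scales under the flow exactly like a known weight; the
quotient of `φ` by this weight is locally constant on the connected set of values (`exists_eq_mul`).
-/

/-! ### Signatures modulo four -/

/-- With `m` negative weights the sum is `card - 2m` and the product has sign `(-1)^m`, so modulo 4
both sides depend on `m` only through its parity. -/
theorem sum_sign_modEq_four {ι : Type*} (s : Finset ι) (w : ι → ℝ) (hw : ∀ i ∈ s, w i ≠ 0) :
    ∑ i ∈ s, (SignType.sign (w i) : ℤ) ≡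
      (s.card : ℤ) + 1 - (SignType.sign (∏ i ∈ s, w i) : ℤ) [ZMOD 4] := by
  classical
  induction s using Finset.induction_on with
  | empty => simp
  | insert a s ha ih =>
    have ih := ih fun i hi => hw i (Finset.mem_insert_of_mem hi)
    have hp : ∏ i ∈ s, w i ≠ 0 :=
      Finset.prod_ne_zero_iff.2 fun i hi => hw i (Finset.mem_insert_of_mem hi)
    have hwa := hw a (Finset.mem_insert_self a s)
    rw [Finset.sum_insert ha, Finset.prod_insert ha, Finset.card_insert_of_notMem ha, sign_mul]
    rcases lt_or_gt_of_ne hwa with h1 | h1 <;> rcases lt_or_gt_of_ne hp with h2 | h2 <;>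
      simp only [h1, h2, sign_neg, sign_pos, Int.ModEq, SignType.coe_neg_one, SignType.coe_one,
        mul_one, mul_neg, neg_neg] at ih ⊢ <;> push_cast <;> omega

theorem ncard_pos_sub_ncard_neg {ι : Type*} [Fintype ι] (w : ι → ℝ) :
    (({i | 0 < w i}.ncard : ℕ) : ℤ) - ({i | w i < 0}.ncard : ℕ) =
      ∑ i, (SignType.sign (w i) : ℤ) := by
  classical
  have h (p : ι → Prop) [DecidablePred p] :
      (({i | p i}.ncard : ℕ) : ℤ) = ∑ i, if p i then 1 else 0 := by
    rw [Set.ncard_eq_toFinset_card', Finset.sum_boole]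
    simp
  rw [h, h, ← Finset.sum_sub_distrib]
  refine Finset.sum_congr rfl fun i _ => ?_
  rcases lt_trichotomy (w i) 0 with h1 | h1 | h1
  · simp [h1, not_lt.2 h1.le]
  · simp [h1]
  · simp [h1, not_lt.2 h1.le]

/-- The signature modulo `4` of a nondegenerate symmetric form is determined by the dimension and
the sign of the Gram determinant. -/
theorem signature_modEq_four {V : Type*} [AddCommGroup V] [Module ℝ V] {n : ℕ}
    (b : Module.Basis (Fin n) ℝ V) (B : LinearMap.BilinForm ℝ V) (hB : ∀ x y, B x y = B y x)
    (hdet : (Matrix.of fun i j => B (b i) (b j)).det ≠ 0) :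
    signature B ≡
      n + 1 - (SignType.sign (Matrix.of fun i j => B (b i) (b j)).det : ℤ) [ZMOD 4] := by
  have : FiniteDimensional ℝ V := b.finiteDimensional_of_finite
  have hfin : Module.finrank ℝ V = n := by simpa using Module.finrank_eq_card_basis b
  subst hfin
  obtain ⟨c, hc⟩ := LinearMap.BilinForm.exists_orthogonal_basis (B := B) ⟨hB⟩
  set Q : QuadraticForm ℝ V := LinearMap.BilinMap.toQuadraticMap B with hQ
  have hassoc : QuadraticMap.associated (R := ℝ) Q = B :=
    QuadraticMap.associated_left_inverse ℝ hB
  have hequiv : QuadraticMap.Equivalent Q (QuadraticMap.weightedSumSquares ℝ fun i => Q (c i)) :=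
    ⟨QuadraticForm.isometryEquivWeightedSumSquares Q c (by rw [hassoc]; exact hc)⟩
  -- Passing to an orthogonal basis changes the Gram determinant by a positive square, so its sign
  -- is that of the product of the diagonal weights.
  have hgram : (Matrix.of fun i j => B (b i) (b j)).det =
      (c.toMatrix b).det ^ 2 * ∏ i, Q (c i) := by
    have h1 : (Matrix.of fun i j => B (b i) (b j)) = LinearMap.BilinForm.toMatrix b B := by
      ext i j; simp [LinearMap.BilinForm.toMatrix_apply]
    have h2 : LinearMap.BilinForm.toMatrix c B = Matrix.diagonal fun i => Q (c i) := by
      ext i j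
      rw [LinearMap.BilinForm.toMatrix_apply, Matrix.diagonal_apply]
      split_ifs with hij
      · subst hij; simp [hQ]
      · exact hc hij
    rw [h1, ← LinearMap.BilinForm.toMatrix_mul_basis_toMatrix c b B, h2, Matrix.det_mul,
      Matrix.det_mul, Matrix.det_transpose, Matrix.det_diagonal]
    ring
  rw [hgram] at hdet ⊢
  have hsq : 0 < (c.toMatrix b).det ^ 2 := by
    have : (c.toMatrix b).det ^ 2 ≠ 0 := left_ne_zero_of_mul hdet
    positivity
  rw [sign_mul, sign_pos hsq, one_mul]
  unfold signature
  rw [QuadraticForm.sigPos_of_equiv_weightedSumSquares hequiv,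
    QuadraticForm.sigNeg_of_equiv_weightedSumSquares hequiv, ncard_pos_sub_ncard_neg]
  have := sum_sign_modEq_four Finset.univ (fun i => Q (c i)) fun i hi =>
    Finset.prod_ne_zero_iff.1 (right_ne_zero_of_mul hdet) i hi
  simpa using this

/-! ### Tangent spaces of level sets -/

/-- A function vanishing on `M` near `x` has zero derivative on the tangent space of `M`. -/
theorem fderiv_apply_eq_zero_of_eventually {n : ℕ} {E : Type*} [NormedAddCommGroup E]
    [NormedSpace ℝ E] {M : Set (Fin (n + 1) → ℝ)} {x : Fin (n + 1) → ℝ}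
    {g : (Fin (n + 1) → ℝ) → E} (hg : DifferentiableAt ℝ g x) (h0 : ∀ᶠ y in 𝓝[M] x, g y = 0)
    {X : Fin (n + 1) → ℝ} (hX : X ∈ tangent M x) : fderiv ℝ g x X = 0 := by
  suffices h : tangent M x ≤ LinearMap.ker (fderiv ℝ g x).toLinearMap from h hX
  refine Submodule.span_le.2 ?_
  rintro X ⟨γ, rfl, hM, hγ⟩
  have hcomp := hg.hasFDerivAt.comp_hasDerivAt (0 : ℝ) hγ
  have htend : Filter.Tendsto γ (𝓝 0) (𝓝[M] (γ 0)) :=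
    tendsto_nhdsWithin_iff.2 ⟨hγ.continuousAt, hM⟩
  have hev : (g ∘ γ) =ᶠ[𝓝 0] fun _ => 0 := htend.eventually h0
  have := (hasDerivAt_const (0 : ℝ) (0 : E)).congr_of_eventuallyEq hev
  exact hcomp.unique this

/-- The tangent space of a regular level set is the kernel of the differential. -/
theorem mem_tangent_levelSet {n : ℕ} {Ω : Set (Fin (n + 1) → ℝ)} (hΩ : IsOpen Ω)
    {F : (Fin (n + 1) → ℝ) → ℝ} {x : Fin (n + 1) → ℝ} (hx : x ∈ Ω) (hF : ContDiffAt ℝ ∞ F x)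
    (hdF : fderiv ℝ F x ≠ 0) {X : Fin (n + 1) → ℝ} :
    X ∈ tangent {y ∈ Ω | F y = F x} x ↔ fderiv ℝ F x X = 0 := by
  have hd : DifferentiableAt ℝ F x := hF.differentiableAt (by simp)
  constructor
  · intro hX
    have := fderiv_apply_eq_zero_of_eventually (g := fun y => F y - F x) (hd.sub_const _)
      (eventually_nhdsWithin_of_forall fun y hy => sub_eq_zero.2 hy.2) hX
    rwa [fderiv_sub_const] at this
  · intro hX
    have hs : HasStrictFDerivAt F (fderiv ℝ F x) x := hF.hasStrictFDerivAt (by simp)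
    have hr : (fderiv ℝ F x).range = ⊤ := by
      refine LinearMap.range_eq_top.2 ?_
      exact LinearMap.surjective (fun h => hdF (by ext1 y; exact congrArg (fun f => f y) h))
    let X' : (fderiv ℝ F x).ker := ⟨X, hX⟩
    -- The implicit function parametrizes the level set over the kernel of `dF`; the image of the
    -- line `t • X` is a curve in the level set with velocity `X`.
    refine Submodule.subset_span ⟨fun t => hs.implicitFunction F _ hr (F x) (t • X'), ?_, ?_, ?_⟩
    · simp
    · have h1 : Filter.Tendsto (fun t : ℝ => (F x, t • X')) (𝓝 0) (𝓝 (F x, 0)) := by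
        have : Continuous fun t : ℝ => (F x, t • X') := by fun_prop
        simpa using this.tendsto 0
      have h2 : Filter.Tendsto (fun t : ℝ => hs.implicitFunction F _ hr (F x) (t • X'))
          (𝓝 0) (𝓝 x) := by
        refine hs.tendsto_implicitFunction hr tendsto_const_nhds ?_
        have : Continuous fun t : ℝ => t • X' := by fun_prop
        simpa using this.tendsto 0
      filter_upwards [h1.eventually (hs.map_implicitFunction_eq hr),
        h2.eventually (hΩ.mem_nhds hx)] with t ht1 ht2
      exact ⟨ht2, ht1⟩
    · have h1 : HasDerivAt (fun t : ℝ => t • X') X' 0 := by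
        simpa using (hasDerivAt_id (0 : ℝ)).smul_const X'
      have h2 := (hs.to_implicitFunction hr).hasFDerivAt
      rw [← zero_smul ℝ X'] at h2
      exact h2.comp_hasDerivAt (0 : ℝ) h1

/-! ### Euler's identity and the Hessian -/

variable {n : ℕ}

/-- The generator `(1 - ε)(x - v) + ε v` of the flow under which `F` is affinely homogeneous. -/
def radial (ε : ℝ) (v x : Fin (n + 1) → ℝ) : Fin (n + 1) → ℝ :=
  (1 - ε) • (x - v) + ε • v

/-- The Hessian of `F` at `x` as a bilinear form. -/
def hessForm (F : (Fin (n + 1) → ℝ) → ℝ) (x : Fin (n + 1) → ℝ) :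
    LinearMap.BilinForm ℝ (Fin (n + 1) → ℝ) :=
  ContinuousLinearMap.coeLM ℝ ∘ₗ (fderiv ℝ (fderiv ℝ F) x).toLinearMap

theorem hasFDerivAt_radial (ε : ℝ) (v x : Fin (n + 1) → ℝ) :
    HasFDerivAt (radial ε v) ((1 - ε) • ContinuousLinearMap.id ℝ (Fin (n + 1) → ℝ)) x := by
  unfold radial
  exact (((hasFDerivAt_id x).sub_const v).const_smul (1 - ε)).add_const _

theorem contDiff_radial (ε : ℝ) (v : Fin (n + 1) → ℝ) : ContDiff ℝ ∞ (radial ε v) := by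
  unfold radial
  fun_prop

theorem diff_dotProduct (F : (Fin (n + 1) → ℝ) → ℝ) (x X : Fin (n + 1) → ℝ) :
    diff F x ⬝ᵥ X = fderiv ℝ F x X := by
  conv_rhs => rw [pi_eq_sum_univ' X, map_sum]
  simp only [dotProduct, diff, map_smul, smul_eq_mul, mul_comm]

theorem hess_mulVec_apply (F : (Fin (n + 1) → ℝ) → ℝ) (x Y : Fin (n + 1) → ℝ) (i : Fin (n + 1)) :
    (hess F x).mulVec Y i = fderiv ℝ (fderiv ℝ F) x (Pi.single i 1) Y := by
  conv_rhs => rw [pi_eq_sum_univ' Y, map_sum]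
  simp only [Matrix.mulVec, dotProduct, hess, Matrix.of_apply, map_smul, smul_eq_mul, mul_comm]

theorem dotProduct_hess_mulVec (F : (Fin (n + 1) → ℝ) → ℝ) (x X Y : Fin (n + 1) → ℝ) :
    X ⬝ᵥ (hess F x).mulVec Y = fderiv ℝ (fderiv ℝ F) x X Y := by
  conv_rhs => rw [pi_eq_sum_univ' X, map_sum, sum_apply]
  simp only [dotProduct, hess_mulVec_apply, map_smul, smul_apply, smul_eq_mul]

/-- `F` is smooth on `Ω ∩ F ⁻¹' I`, satisfies there Euler's identity `dF(E) = λ F + α` for the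
radial field `E`, and `λ F + α` does not vanish there. -/
structure IsEulerRegular (lam ε α : ℝ) (Ω : Set (Fin (n + 1) → ℝ)) (v : Fin (n + 1) → ℝ)
    (F : (Fin (n + 1) → ℝ) → ℝ) (I : Set ℝ) : Prop where
  isOpen : IsOpen Ω
  isOpen_preimage : IsOpen (Ω ∩ F ⁻¹' I)
  contDiffAt : ∀ x ∈ Ω ∩ F ⁻¹' I, ContDiffAt ℝ ∞ F x
  euler : ∀ x ∈ Ω ∩ F ⁻¹' I, fderiv ℝ F x (radial ε v x) = lam * F x + α
  regular : ∀ r ∈ I, lam * r + α ≠ 0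

namespace IsEulerRegular

variable {lam ε α : ℝ} {Ω : Set (Fin (n + 1) → ℝ)} {v : Fin (n + 1) → ℝ}
  {F : (Fin (n + 1) → ℝ) → ℝ} {I : Set ℝ} {x : Fin (n + 1) → ℝ}

theorem differentiableAt (hF : IsEulerRegular lam ε α Ω v F I) (hx : x ∈ Ω ∩ F ⁻¹' I) :
    DifferentiableAt ℝ F x :=
  (hF.contDiffAt x hx).differentiableAt (by simp)

theorem contDiffAt_fderiv (hF : IsEulerRegular lam ε α Ω v F I) (hx : x ∈ Ω ∩ F ⁻¹' I) :
    ContDiffAt ℝ ∞ (fderiv ℝ F) x :=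
  (hF.contDiffAt x hx).fderiv_right (by simp)

theorem differentiableAt_fderiv (hF : IsEulerRegular lam ε α Ω v F I) (hx : x ∈ Ω ∩ F ⁻¹' I) :
    DifferentiableAt ℝ (fderiv ℝ F) x :=
  (hF.contDiffAt_fderiv hx).differentiableAt (by simp)

theorem fderiv_radial_ne_zero (hF : IsEulerRegular lam ε α Ω v F I) (hx : x ∈ Ω ∩ F ⁻¹' I) :
    fderiv ℝ F x (radial ε v x) ≠ 0 := by
  rw [hF.euler x hx]
  exact hF.regular _ hx.2

theorem fderiv_ne_zero (hF : IsEulerRegular lam ε α Ω v F I) (hx : x ∈ Ω ∩ F ⁻¹' I) :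
    fderiv ℝ F x ≠ 0 := fun h => hF.fderiv_radial_ne_zero hx (by simp [h])

theorem hess_symm (hF : IsEulerRegular lam ε α Ω v F I) (hx : x ∈ Ω ∩ F ⁻¹' I)
    (X Y : Fin (n + 1) → ℝ) :
    fderiv ℝ (fderiv ℝ F) x X Y = fderiv ℝ (fderiv ℝ F) x Y X :=
  (hF.contDiffAt x hx).isSymmSndFDerivAt
    (by rw [minSmoothness_of_isRCLikeNormedField]; exact ENat.LEInfty.out) X Y

/-- The derivative of Euler's identity: the Hessian maps the radial field to a multiple of `dF`. -/
theorem hess_radial (hF : IsEulerRegular lam ε α Ω v F I) (hx : x ∈ Ω ∩ F ⁻¹' I)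
    (X : Fin (n + 1) → ℝ) :
    fderiv ℝ (fderiv ℝ F) x X (radial ε v x) = (lam - (1 - ε)) * fderiv ℝ F x X := by
  have h1 := ((hF.differentiableAt_fderiv hx).hasFDerivAt).clm_apply (hasFDerivAt_radial ε v x)
  have h2 : HasFDerivAt (fun y => lam * F y + α) (lam • fderiv ℝ F x) x :=
    ((hF.differentiableAt hx).hasFDerivAt.const_mul lam).add_const α
  have hev : (fun y => fderiv ℝ F y (radial ε v y)) =ᶠ[𝓝 x] fun y => lam * F y + α := by
    filter_upwards [hF.isOpen_preimage.mem_nhds hx] with y hy using hF.euler y hy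
  have h3 := congrArg (fun L => L X) ((h2.congr_of_eventuallyEq hev).unique h1)
  simp at h3
  linarith

theorem hess_mulVec_radial (hF : IsEulerRegular lam ε α Ω v F I) (hx : x ∈ Ω ∩ F ⁻¹' I) :
    (hess F x).mulVec (radial ε v x) = (lam - (1 - ε)) • diff F x := by
  ext i
  rw [hess_mulVec_apply, hF.hess_radial hx]
  rfl

/-- Apply the adjugate to `Hess F · E = μ dF` and pair with `dF`: one side is `μ U(F)`, the other
`H(F) dF(E)`. -/
theorem mul_adjQuad (hF : IsEulerRegular lam ε α Ω v F I) (hx : x ∈ Ω ∩ F ⁻¹' I) :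
    (lam - (1 - ε)) * adjQuad F x = (lam * F x + α) * hessDet F x := by
  unfold adjQuad
  rw [← smul_eq_mul, ← dotProduct_smul, ← Matrix.mulVec_smul, ← hF.hess_mulVec_radial hx,
    Matrix.mulVec_mulVec, Matrix.adjugate_mul, Matrix.smul_mulVec, Matrix.one_mulVec,
    dotProduct_smul, diff_dotProduct, hF.euler x hx, hessDet, smul_eq_mul, mul_comm]

/-- The field that defines the co-orientation is therefore a multiple of the radial field. -/
theorem hessGrad_eq (hF : IsEulerRegular lam ε α Ω v F I) (hx : x ∈ Ω ∩ F ⁻¹' I)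
    (hμ : lam - (1 - ε) ≠ 0) (hdet : hessDet F x ≠ 0) :
    hessGrad F x = (lam - (1 - ε))⁻¹ • radial ε v x := by
  unfold hessGrad
  have h : diff F x = (lam - (1 - ε))⁻¹ • (hess F x).mulVec (radial ε v x) := by
    rw [hF.hess_mulVec_radial hx, smul_smul, inv_mul_cancel₀ hμ, one_smul]
  rw [h, Matrix.mulVec_smul, Matrix.mulVec_mulVec,
    Matrix.nonsing_inv_mul _ (isUnit_iff_ne_zero.2 hdet), Matrix.one_mulVec]

/-- The Gram determinant of the Hessian on vectors tangent to the level set. -/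
theorem gram_det (hF : IsEulerRegular lam ε α Ω v F I) (hx : x ∈ Ω ∩ F ⁻¹' I)
    (X : Fin n → Fin (n + 1) → ℝ) (hX : ∀ i, fderiv ℝ F x (X i) = 0) :
    (lam - (1 - ε)) * (lam * F x + α) *
        (Matrix.of fun i j => fderiv ℝ (fderiv ℝ F) x (X i) (X j)).det =
      hessDet F x * (Matrix.of (Matrix.vecCons (radial ε v x) X)).det ^ 2 := by
  set P := Matrix.of (Matrix.vecCons (radial ε v x) X) with hP
  have hentry : ∀ i j, (P * hess F x * P.transpose) i j =
      fderiv ℝ (fderiv ℝ F) x (P i) (P j) := by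
    intro i j
    rw [← dotProduct_hess_mulVec, Matrix.mul_assoc, Matrix.mul_apply]
    simp only [dotProduct, Matrix.mulVec, Matrix.mul_apply, Matrix.transpose_apply]
  have h1 : (P * hess F x * P.transpose).det = hessDet F x * P.det ^ 2 := by
    rw [Matrix.det_mul, Matrix.det_mul, Matrix.det_transpose, hessDet]
    ring
  -- The first row of `P Hess Pᵀ` is `(μ (lam * F + α), 0, …, 0)`, since `Hess(E, X i) = μ dF(X i) =
  -- 0`; only one term of the Laplace expansion survives.
  rw [← h1, Matrix.det_succ_row_zero, Fin.sum_univ_succ, Finset.sum_eq_zero, add_zero]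
  · have h00 : (P * hess F x * P.transpose) 0 0 = (lam - (1 - ε)) * (lam * F x + α) := by
      rw [hentry]
      change fderiv ℝ (fderiv ℝ F) x (radial ε v x) (radial ε v x) = _
      rw [hF.hess_radial hx, hF.euler x hx]
    rw [h00]
    have : (P * hess F x * P.transpose).submatrix Fin.succ (Fin.succAbove 0) =
        Matrix.of fun i j => fderiv ℝ (fderiv ℝ F) x (X i) (X j) := by
      ext i j
      rw [Matrix.submatrix_apply, hentry]
      rfl
    rw [this]
    simp
  · intro j _
    have : (P * hess F x * P.transpose) 0 j.succ = 0 := by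
      rw [hentry, hF.hess_symm hx]
      change fderiv ℝ (fderiv ℝ F) x (X j) (radial ε v x) = 0
      rw [hF.hess_radial hx, hX, mul_zero]
    rw [this]
    simp

theorem mem_tangent (hF : IsEulerRegular lam ε α Ω v F I) {r : ℝ} (hr : r ∈ I)
    (hx : x ∈ {y ∈ Ω | F y = r}) {X : Fin (n + 1) → ℝ} :
    X ∈ tangent {y ∈ Ω | F y = r} x ↔ fderiv ℝ F x X = 0 := by
  obtain ⟨hxΩ, rfl⟩ := hx
  exact mem_tangent_levelSet hF.isOpen hxΩ (hF.contDiffAt x ⟨hxΩ, hr⟩) (hF.fderiv_ne_zero ⟨hxΩ, hr⟩)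

theorem radial_notMem_tangent (hF : IsEulerRegular lam ε α Ω v F I) {r : ℝ} (hr : r ∈ I)
    (hx : x ∈ {y ∈ Ω | F y = r}) : radial ε v x ∉ tangent {y ∈ Ω | F y = r} x := by
  rw [hF.mem_tangent hr hx]
  exact hF.fderiv_radial_ne_zero ⟨hx.1, by simpa [hx.2] using hr⟩

theorem finrank_tangent (hF : IsEulerRegular lam ε α Ω v F I) {r : ℝ} (hr : r ∈ I)
    (hx : x ∈ {y ∈ Ω | F y = r}) : Module.finrank ℝ (tangent {y ∈ Ω | F y = r} x) = n := by
  have hne := hF.fderiv_ne_zero (x := x) ⟨hx.1, by simpa [hx.2] using hr⟩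
  have h1 : tangent {y ∈ Ω | F y = r} x = LinearMap.ker (fderiv ℝ F x).toLinearMap := by
    ext X
    exact hF.mem_tangent hr hx
  have h2 := Module.Dual.finrank_ker_add_one_of_ne_zero (f := (fderiv ℝ F x).toLinearMap)
    (fun h => hne (by ext1 y; exact congrArg (fun f => f y) h))
  rw [Module.finrank_fin_fun] at h2
  rw [h1]
  omega

theorem det_vecCons_radial_ne_zero (hF : IsEulerRegular lam ε α Ω v F I) {r : ℝ} (hr : r ∈ I)
    (hx : x ∈ {y ∈ Ω | F y = r}) (b : Module.Basis (Fin n) ℝ (tangent {y ∈ Ω | F y = r} x)) :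
    (Matrix.of (Matrix.vecCons (radial ε v x) fun i => (b i : Fin (n + 1) → ℝ))).det ≠ 0 := by
  have h1 : LinearIndependent ℝ fun i => (b i : Fin (n + 1) → ℝ) :=
    b.linearIndependent.map' (Submodule.subtype _) (Submodule.ker_subtype _)
  have h2 : Submodule.span ℝ (Set.range fun i => (b i : Fin (n + 1) → ℝ)) ≤
      tangent {y ∈ Ω | F y = r} x :=
    Submodule.span_le.2 (by rintro _ ⟨i, rfl⟩; exact (b i).2)
  have h3 := linearIndependent_finCons.2
    ⟨h1, fun h => hF.radial_notMem_tangent hr hx (h2 h)⟩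
  exact (Matrix.linearIndependent_rows_iff_isUnit.1 h3 |> (Matrix.isUnit_iff_isUnit_det _).1).ne_zero

end IsEulerRegular

/-! ### Equiaffine normals of level sets -/

namespace IsEulerRegular

variable {lam ε α : ℝ} {Ω : Set (Fin (n + 1) → ℝ)} {v : Fin (n + 1) → ℝ}
  {F : (Fin (n + 1) → ℝ) → ℝ} {I : Set ℝ} {x : Fin (n + 1) → ℝ} {r : ℝ}

theorem mem_preimage (hr : r ∈ I) (hx : x ∈ {y ∈ Ω | F y = r}) : x ∈ Ω ∩ F ⁻¹' I :=
  ⟨hx.1, by simpa [hx.2] using hr⟩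

/-- Differentiating `dF(Y) = 0` along the level set. -/
theorem hess_add_fderiv_eq_zero (hF : IsEulerRegular lam ε α Ω v F I) (hr : r ∈ I)
    (hx : x ∈ {y ∈ Ω | F y = r}) {X : Fin (n + 1) → ℝ} (hX : X ∈ tangent {y ∈ Ω | F y = r} x)
    {Y : (Fin (n + 1) → ℝ) → (Fin (n + 1) → ℝ)} (hY : ContDiffAt ℝ ∞ Y x)
    (hYt : ∀ᶠ y in 𝓝[{y ∈ Ω | F y = r}] x, Y y ∈ tangent {y ∈ Ω | F y = r} y) :
    fderiv ℝ (fderiv ℝ F) x X (Y x) + fderiv ℝ F x (fderiv ℝ Y x X) = 0 := by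
  have h1 := ((hF.differentiableAt_fderiv (mem_preimage hr hx)).hasFDerivAt).clm_apply
    (hY.differentiableAt (by simp)).hasFDerivAt
  have h2 : ∀ᶠ y in 𝓝[{y ∈ Ω | F y = r}] x, fderiv ℝ F y (Y y) = 0 := by
    filter_upwards [hYt, self_mem_nhdsWithin] with y hy hyM
    exact (hF.mem_tangent hr hyM).1 hy
  have h3 := fderiv_apply_eq_zero_of_eventually h1.differentiableAt h2 hX
  rw [h1.fderiv] at h3
  simp at h3
  linarith

/-- Every tangent vector extends to a local vector field tangent to the level set. -/
theorem exists_tangent_extension (hF : IsEulerRegular lam ε α Ω v F I) (hr : r ∈ I)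
    (hx : x ∈ {y ∈ Ω | F y = r}) {Z : Fin (n + 1) → ℝ} (hZ : Z ∈ tangent {y ∈ Ω | F y = r} x) :
    ∃ Y : (Fin (n + 1) → ℝ) → (Fin (n + 1) → ℝ), ContDiffAt ℝ ∞ Y x ∧ Y x = Z ∧
      ∀ᶠ y in 𝓝[{y ∈ Ω | F y = r}] x, Y y ∈ tangent {y ∈ Ω | F y = r} y := by
  have hxN := mem_preimage hr hx
  -- The constant field `Z` is projected along the radial field onto the kernel of `dF`.
  refine ⟨fun y => Z - (fderiv ℝ F y Z / fderiv ℝ F y (radial ε v y)) • radial ε v y, ?_, ?_, ?_⟩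
  · have hd := hF.contDiffAt_fderiv hxN
    have hrad := (contDiff_radial ε v).contDiffAt (x := x)
    exact contDiffAt_const.sub (((hd.clm_apply contDiffAt_const).div (hd.clm_apply hrad)
      (hF.fderiv_radial_ne_zero hxN)).smul hrad)
  · simp [(hF.mem_tangent hr hx).1 hZ]
  · filter_upwards [self_mem_nhdsWithin] with y hy
    rw [hF.mem_tangent hr hy]
    have := hF.fderiv_radial_ne_zero (mem_preimage hr hy)
    simp [this]

/-- The Gram determinant of the metric induced on the level set by a multiple of the radial
field. -/
theorem det_metric (hF : IsEulerRegular lam ε α Ω v F I) (hr : r ∈ I)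
    (hx : x ∈ {y ∈ Ω | F y = r}) {c : ℝ}
    {h : LinearMap.BilinForm ℝ (tangent {y ∈ Ω | F y = r} x)}
    (hh : ∀ X Y, c * h X Y = fderiv ℝ (fderiv ℝ F) x X Y)
    (X : Fin n → tangent {y ∈ Ω | F y = r} x) :
    c ^ n * ((lam - (1 - ε)) * (lam * r + α)) * (Matrix.of fun i j => h (X i) (X j)).det =
      hessDet F x *
        (Matrix.of (Matrix.vecCons (radial ε v x) fun i => (X i : Fin (n + 1) → ℝ))).det ^ 2 := by
  rw [← hF.gram_det (mem_preimage hr hx) _ fun i => (hF.mem_tangent hr hx).1 (X i).2, hx.2]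
  have : (Matrix.of fun i j => fderiv ℝ (fderiv ℝ F) x (X i) (X j)) =
      c • Matrix.of fun i j => h (X i) (X j) := by
    ext i j
    simp [hh]
  rw [this, Matrix.det_smul, Fintype.card_fin]
  ring

theorem det_vecCons_smul (k : ℝ) (Z : Fin (n + 1) → ℝ) (X : Fin n → Fin (n + 1) → ℝ) :
    (Matrix.of (Matrix.vecCons (k • Z) X)).det = k * (Matrix.of (Matrix.vecCons Z X)).det := by
  have h1 : ∀ W : Fin (n + 1) → ℝ, Matrix.of (Matrix.vecCons W X) =
      (Matrix.of (Matrix.vecCons Z X)).updateRow 0 W := by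
    intro W
    ext i j
    refine Fin.cases ?_ (fun i => ?_) i <;> simp
  rw [h1, Matrix.det_updateRow_smul, ← h1]

/-- Since the other factors depend only on `r` and `c`, the signature modulo 4 detects the sign of
the Hessian determinant. -/
theorem signature_metric_modEq (hF : IsEulerRegular lam ε α Ω v F I) (hr : r ∈ I)
    (hμ : lam - (1 - ε) ≠ 0) (hx : x ∈ {y ∈ Ω | F y = r}) {c : ℝ} (hc : c ≠ 0)
    {h : LinearMap.BilinForm ℝ (tangent {y ∈ Ω | F y = r} x)}
    (hh : ∀ X Y, c * h X Y = fderiv ℝ (fderiv ℝ F) x X Y) (hdet : hessDet F x ≠ 0) :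
    signature h ≡ n + 1 - (SignType.sign (c ^ n * ((lam - (1 - ε)) * (lam * r + α))) : ℤ) *
      (SignType.sign (hessDet F x) : ℤ) [ZMOD 4] := by
  let b := Module.finBasisOfFinrankEq ℝ _ (hF.finrank_tangent hr hx)
  have hD := hF.det_vecCons_radial_ne_zero hr hx b
  have hC : c ^ n * ((lam - (1 - ε)) * (lam * r + α)) ≠ 0 :=
    mul_ne_zero (pow_ne_zero _ hc) (mul_ne_zero hμ (hF.regular r hr))
  have hgram := hF.det_metric hr hx hh b
  have hdeth : (Matrix.of fun i j => h (b i) (b j)).det ≠ 0 := by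
    intro h0
    rw [h0, mul_zero] at hgram
    exact mul_ne_zero hdet (pow_ne_zero 2 hD) hgram.symm
  have hsymm : ∀ X Y, h X Y = h Y X := fun X Y =>
    mul_left_cancel₀ hc (by rw [hh, hh, hF.hess_symm (mem_preimage hr hx)])
  refine (signature_modEq_four b h hsymm hdeth).trans ?_
  have hsign := congrArg SignType.sign hgram
  rw [sign_mul, sign_mul (hessDet F x),
    sign_pos (a := _ ^ 2) (by positivity), mul_one] at hsign
  rw [← hsign]
  rcases lt_or_gt_of_ne hC with h1 | h1 <;> simp [sign_neg, sign_pos, h1]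

/-- A level set on which the Hessian determinant is constant has a multiple of the radial field as
its equiaffine normal. -/
theorem isEquiaffine_levelSet (hF : IsEulerRegular lam ε α Ω v F I) (hr : r ∈ I)
    (hμ : lam - (1 - ε) ≠ 0) {k p : ℝ} (hp : p ≠ 0) (hk : k * (lam * r + α) < 0)
    (hkp : |k| ^ (n + 2) * |lam - (1 - ε)| * |lam * r + α| ^ (n + 1) = |p|)
    (hH : ∀ x ∈ {y ∈ Ω | F y = r}, hessDet F x = p) :
    IsEquiaffine {y ∈ Ω | F y = r} (stdCoorient F) (fun x => k • radial ε v x)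
      (fun x => (-(k * (lam * r + α)))⁻¹ •
        (hessForm F x).restrict (tangent {y ∈ Ω | F y = r} x))
      (fun _ => -(k * (1 - ε)) • LinearMap.id) := by
  have hk0 : k ≠ 0 := left_ne_zero_of_mul hk.ne
  have hd := hF.regular r hr
  have hc : -(k * (lam * r + α)) ≠ 0 := neg_ne_zero.2 hk.ne
  have hh : ∀ x, ∀ X Y : tangent {y ∈ Ω | F y = r} x, -(k * (lam * r + α)) *
      ((-(k * (lam * r + α)))⁻¹ •
        (hessForm F x).restrict (tangent {y ∈ Ω | F y = r} x)) X Y =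
        fderiv ℝ (fderiv ℝ F) x X Y := by
    intro x X Y
    simp only [LinearMap.smul_apply, LinearMap.BilinForm.restrict_apply, smul_eq_mul]
    rw [mul_inv_cancel_left₀ hc]
    rfl
  refine ⟨?_, ?_, ?_, ?_, ?_, ?_, ?_, ?_⟩
  · intro x hx
    refine ⟨Ω ∩ F ⁻¹' I, fun y => F y - r, hF.isOpen_preimage, mem_preimage hr hx, ?_, ?_, ?_⟩
    · exact fun y hy => ((hF.contDiffAt y hy).sub contDiffAt_const).contDiffWithinAt
    · intro y hy
      rw [fderiv_sub_const]
      exact hF.fderiv_ne_zero hy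
    · ext y
      simp only [Set.mem_inter_iff, Set.mem_ofPred_eq, sub_eq_zero]
      tauto
  · exact ⟨Set.univ, isOpen_univ, Set.subset_univ _,
      ((contDiff_radial ε v).const_smul k).contDiffOn⟩
  · intro x hx hmem
    exact hF.radial_notMem_tangent hr hx ((Submodule.smul_mem_iff _ hk0).1 hmem)
  · intro x hx
    have hdet : hessDet F x ≠ 0 := by rw [hH x hx]; exact hp
    have hadj := hF.mul_adjQuad (mem_preimage hr hx)
    rw [hx.2] at hadj
    set μ := lam - (1 - ε) with hμdef
    set d := lam * r + α with hddef
    -- `U(F) H(F)` has the sign of `μ d`, so the co-orientation is `-sign(μ d) μ⁻¹ E`. As `k * d <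
    -- 0`, the field `k E` is the positive multiple `|k μ|` of it.
    have hUH : μ ^ 2 * (adjQuad F x * hessDet F x) = (μ * d) * hessDet F x ^ 2 := by
      linear_combination (μ * hessDet F x) * hadj
    have hgrad := hF.hessGrad_eq (mem_preimage hr hx) hμ hdet
    have hHsq : 0 < hessDet F x ^ 2 := by positivity
    have hμsq : 0 < μ ^ 2 := by positivity
    have hdsq : 0 < d ^ 2 := by positivity
    unfold stdCoorient
    rw [hgrad]
    rcases lt_or_gt_of_ne (mul_ne_zero hμ hd) with hμd | hμd
    · have hneg : adjQuad F x * hessDet F x < 0 := by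
        have : μ ^ 2 * (adjQuad F x * hessDet F x) < 0 := by
          rw [hUH]; exact mul_neg_of_neg_of_pos hμd hHsq
        exact (pos_iff_neg_of_mul_neg this).1 hμsq
      refine ⟨k * μ, ?_, ?_⟩
      · have := mul_pos_of_neg_of_neg hk hμd
        have h2 : 0 < (k * μ) * d ^ 2 := by linarith
        exact pos_of_mul_pos_left h2 hdsq.le
      · rw [Real.sign_of_neg hneg, neg_neg, one_smul, smul_smul, mul_assoc, mul_inv_cancel₀ hμ,
          mul_one, sub_self]
        exact zero_mem _
    · have hpos : 0 < adjQuad F x * hessDet F x := by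
        have : 0 < μ ^ 2 * (adjQuad F x * hessDet F x) := by
          rw [hUH]; exact mul_pos hμd hHsq
        exact pos_of_mul_pos_right this hμsq.le
      refine ⟨-(k * μ), ?_, ?_⟩
      · have := mul_neg_of_neg_of_pos hk hμd
        have h2 : 0 < -(k * μ) * d ^ 2 := by linarith
        exact pos_of_mul_pos_left h2 hdsq.le
      · rw [Real.sign_of_pos hpos, neg_smul, neg_smul, one_smul, smul_neg, neg_neg, smul_smul,
          mul_assoc, mul_inv_cancel₀ hμ, mul_one, sub_self]
        exact zero_mem _
  · intro x hx X Y hY hYt hYx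
    rw [hF.mem_tangent hr hx, map_sub, map_smul, map_smul, hF.euler x (mem_preimage hr hx), hx.2,
      smul_eq_mul, smul_eq_mul]
    have h1 := hF.hess_add_fderiv_eq_zero hr hx X.2 hY hYt
    have h2 := hh x X ⟨Y x, hYx⟩
    linear_combination h1 + h2
  · intro x hx X
    have := (hasFDerivAt_radial ε v x).fun_const_smul k
    rw [this.fderiv]
    simp [smul_smul]
  · intro x hx
    let b := Module.finBasisOfFinrankEq ℝ _ (hF.finrank_tangent hr hx)
    refine LinearMap.BilinForm.nondegenerate_of_det_ne_zero _ b ?_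
    intro h0
    have hgram := hF.det_metric hr hx (hh x) b
    have hD := hF.det_vecCons_radial_ne_zero hr hx b
    refine mul_ne_zero (a := hessDet F x) (by rw [hH x hx]; exact hp) (pow_ne_zero 2 hD) ?_
    rw [← hgram]
    refine mul_eq_zero_of_right _ ?_
    convert h0 using 2
    ext i j
    rw [LinearMap.BilinForm.toMatrix_apply]
    rfl
  · intro x hx X
    have hgram := congrArg abs (hF.det_metric hr hx (hh x) X)
    rw [hH x hx, abs_mul, abs_mul p, ← hkp] at hgram
    rw [det_vecCons_smul]
    set D := (Matrix.of (Matrix.vecCons (radial ε v x) fun i => (X i : Fin (n + 1) → ℝ))).det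
    have hC : |(-(k * (lam * r + α))) ^ n * ((lam - (1 - ε)) * (lam * r + α))| ≠ 0 :=
      abs_ne_zero.2 (mul_ne_zero (pow_ne_zero _ hc) (mul_ne_zero hμ hd))
    refine mul_left_cancel₀ hC (hgram.trans ?_)
    rw [abs_sq, abs_mul, abs_mul, abs_pow, abs_neg, abs_mul, mul_pow k, ← sq_abs k]
    ring

/-- The Hessian determinant along a level set whose equiaffine normal is a constant multiple of the
radial field. -/
theorem hessDet_eq_of_isEquiaffine (hF : IsEulerRegular lam ε α Ω v F I) (hr : r ∈ I)
    (hμ : lam - (1 - ε) ≠ 0) {k : ℝ} {κ ξ : (Fin (n + 1) → ℝ) → (Fin (n + 1) → ℝ)}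
    {h : ∀ x, LinearMap.BilinForm ℝ (tangent {y ∈ Ω | F y = r} x)}
    {S : ∀ x, tangent {y ∈ Ω | F y = r} x →ₗ[ℝ] tangent {y ∈ Ω | F y = r} x}
    (hM : IsEquiaffine {y ∈ Ω | F y = r} κ ξ h S)
    (hξ : ∀ x ∈ {y ∈ Ω | F y = r}, ξ x = k • radial ε v x)
    (hsig : ∀ x ∈ {y ∈ Ω | F y = r}, ∀ y ∈ {y ∈ Ω | F y = r},
      signature (h x) ≡ signature (h y) [ZMOD 4]) :
    (∀ x ∈ {y ∈ Ω | F y = r}, hessDet F x ≠ 0) ∧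
      ∀ x ∈ {y ∈ Ω | F y = r}, ∀ y ∈ {y ∈ Ω | F y = r}, hessDet F x = hessDet F y := by
  have hd := hF.regular r hr
  have hk0 : ∀ x ∈ {y ∈ Ω | F y = r}, k ≠ 0 := by
    rintro x hx rfl
    refine hM.transverse x hx ?_
    rw [hξ x hx, zero_smul]
    exact zero_mem _
  -- The Gauss formula concerns vector fields, so the second argument is extended to a tangent
  -- field; applying `dF` then identifies `h`.
  have hh : ∀ x ∈ {y ∈ Ω | F y = r}, ∀ X Y : tangent {y ∈ Ω | F y = r} x,
      -(k * (lam * r + α)) * h x X Y = fderiv ℝ (fderiv ℝ F) x X Y := by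
    intro x hx X Y
    obtain ⟨Z, hZ, hZx, hZt⟩ := hF.exists_tangent_extension hr hx Y.2
    have h1 := hF.hess_add_fderiv_eq_zero hr hx X.2 hZ hZt
    have h2 := hM.gauss x hx X Z hZ hZt (by rw [hZx]; exact Y.2)
    rw [hF.mem_tangent hr hx, map_sub, map_smul, hξ x hx, map_smul,
      hF.euler x (mem_preimage hr hx), hx.2, smul_eq_mul, smul_eq_mul] at h2
    simp only [hZx] at h1 h2
    linear_combination h2 - h1
  have habs : ∀ x ∈ {y ∈ Ω | F y = r},
      |hessDet F x| = |k| ^ (n + 2) * |lam - (1 - ε)| * |lam * r + α| ^ (n + 1) := by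
    intro x hx
    let b := Module.finBasisOfFinrankEq ℝ _ (hF.finrank_tangent hr hx)
    have hD := hF.det_vecCons_radial_ne_zero hr hx b
    have hgram := congrArg abs (hF.det_metric hr hx (hh x hx) b)
    have hvol := hM.volume x hx b
    rw [hξ x hx, det_vecCons_smul] at hvol
    rw [abs_mul, hvol, abs_mul (hessDet F x), abs_sq] at hgram
    refine mul_right_cancel₀ (pow_ne_zero 2 hD) (hgram.symm.trans ?_)
    rw [abs_mul, abs_mul, abs_pow, abs_neg, abs_mul, mul_pow k, ← sq_abs k]
    ring
  have hne : ∀ x ∈ {y ∈ Ω | F y = r}, hessDet F x ≠ 0 := by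
    intro x hx
    have hk := hk0 x hx
    rw [← abs_ne_zero, habs x hx]
    positivity
  refine ⟨hne, fun x hx y hy => ?_⟩
  have hc : -(k * (lam * r + α)) ≠ 0 := neg_ne_zero.2 (mul_ne_zero (hk0 x hx) hd)
  have hC : (-(k * (lam * r + α))) ^ n * ((lam - (1 - ε)) * (lam * r + α)) ≠ 0 :=
    mul_ne_zero (pow_ne_zero _ hc) (mul_ne_zero hμ hd)
  have h1 := hF.signature_metric_modEq hr hμ hx hc (hh x hx) (hne x hx)
  have h2 := hF.signature_metric_modEq hr hμ hy hc (hh y hy) (hne y hy)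
  have h3 := h1.symm.trans ((hsig x hx y hy).trans h2)
  have hxy := (habs x hx).trans (habs y hy).symm
  -- The absolute values agree by `habs`; opposite signs would make the two signatures differ by 2
  -- modulo 4.
  rcases lt_or_gt_of_ne hC with hC | hC <;>
    rcases lt_or_gt_of_ne (hne x hx) with hx0 | hx0 <;>
    rcases lt_or_gt_of_ne (hne y hy) with hy0 | hy0 <;>
    simp only [hC, hx0, hy0, sign_neg, sign_pos, SignType.coe_neg_one, SignType.coe_one,
      Int.ModEq, abs_of_neg, abs_of_pos] at h3 hxy <;> first | linarith | omega

/-- If all equiaffine normal lines of a level set pass through `v`, and its affine mean curvature is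
the constant `A`, then its equiaffine normal is `-A (x - v)`. -/
theorem normal_eq_of_isEquiaffine (hF : IsEulerRegular lam 0 α Ω v F I) (hn : 1 ≤ n) (hr : r ∈ I)
    {A : ℝ} {κ ξ : (Fin (n + 1) → ℝ) → (Fin (n + 1) → ℝ)}
    {h : ∀ x, LinearMap.BilinForm ℝ (tangent {y ∈ Ω | F y = r} x)}
    {S : ∀ x, tangent {y ∈ Ω | F y = r} x →ₗ[ℝ] tangent {y ∈ Ω | F y = r} x}
    (hM : IsEquiaffine {y ∈ Ω | F y = r} κ ξ h S)
    (hv : ∀ x ∈ {y ∈ Ω | F y = r}, ∃ s : ℝ, v = x + s • ξ x)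
    (hA : HasMeanCurvature {y ∈ Ω | F y = r} S A) :
    ∀ x ∈ {y ∈ Ω | F y = r}, ξ x = (-A) • radial 0 v x := by
  -- On the level set this is the proportionality factor of `ξ` and the radial field; as a quotient
  -- it is also defined and differentiable near the level set.
  let k : (Fin (n + 1) → ℝ) → ℝ := fun y =>
    fderiv ℝ F y (ξ y) / fderiv ℝ F y (radial 0 v y)
  have hξ : ∀ x ∈ {y ∈ Ω | F y = r}, ξ x = k x • radial 0 v x := by
    intro x hx
    have hE := hF.fderiv_radial_ne_zero (mem_preimage hr hx)
    obtain ⟨s, hs⟩ := hv x hx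
    have hrad : radial 0 v x = (-s) • ξ x := by
      unfold radial
      rw [sub_zero, one_smul, zero_smul, add_zero, neg_smul]
      nth_rewrite 1 [hs]
      abel
    have hs0 : -s ≠ 0 := by
      intro h0
      rw [hrad, h0, zero_smul, map_zero] at hE
      exact hE rfl
    have hkey : ξ x = (-s)⁻¹ • radial 0 v x := by
      rw [hrad, smul_smul, inv_mul_cancel₀ hs0, one_smul]
    have hkx : k x = (-s)⁻¹ := by
      simp only [k]
      rw [hkey, map_smul, smul_eq_mul, mul_div_assoc, div_self hE, mul_one]
    rw [hkx]
    exact hkey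
  obtain ⟨W, hW, hMW, hsm⟩ := hM.smooth
  intro x hx
  have hxN := mem_preimage hr hx
  have hξd : DifferentiableAt ℝ ξ x :=
    (hsm.contDiffAt (hW.mem_nhds (hMW hx))).differentiableAt (by simp)
  have hrd := (hasFDerivAt_radial 0 v x)
  have hkd : DifferentiableAt ℝ k x := by
    have h1 := (hF.differentiableAt_fderiv hxN).clm_apply hξd
    have h2 := (hF.differentiableAt_fderiv hxN).clm_apply hrd.differentiableAt
    simp only [k, div_eq_mul_inv]
    exact h1.fun_mul (h2.fun_inv (hF.fderiv_radial_ne_zero hxN))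
  -- Differentiating `ξ = k E` along `X` gives `-S X = dk(X) E + k X`. Tangency of `S X` and `X`
  -- forces `dk(X) = 0`.
  have hS : S x = (-k x) • LinearMap.id := by
    ext1 X
    have hG := hξd.hasFDerivAt.fun_sub (hkd.hasFDerivAt.fun_smul hrd)
    have h0 := fderiv_apply_eq_zero_of_eventually (M := {y ∈ Ω | F y = r}) hG.differentiableAt
      (eventually_nhdsWithin_of_forall fun y hy => sub_eq_zero.2 (hξ y hy)) X.2
    rw [hG.fderiv] at h0
    have hw := hM.weingarten x hx X
    simp [hw] at h0
    have h1 : fderiv ℝ F x (S x X) = 0 := (hF.mem_tangent hr hx).1 (S x X).2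
    have h2 : fderiv ℝ F x X = 0 := (hF.mem_tangent hr hx).1 X.2
    have h3 := congrArg (fderiv ℝ F x) h0
    simp [h1, h2] at h3
    have h4 : fderiv ℝ k x X = 0 := by
      rcases h3 with h3 | h3
      · exact h3
      · exact absurd h3 (hF.fderiv_radial_ne_zero hxN)
    ext1
    rw [h4, zero_smul, add_zero] at h0
    simp
    linear_combination -h0
  have htr := hA x hx
  -- The trace determines `k x = -A` at every point, so the factor is the same on all components.
  rw [hS, map_smul, LinearMap.trace_id, hF.finrank_tangent hr hx, smul_eq_mul,
    mul_div_assoc, div_self (by positivity), mul_one] at htr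
  rw [hξ x hx, ← htr, neg_neg]

end IsEulerRegular

/-! ### The flow and the scaling of the Hessian determinant -/

variable {lam ε α : ℝ} {Ω : Set (Fin (n + 1) → ℝ)} {v : Fin (n + 1) → ℝ}
  {F : (Fin (n + 1) → ℝ) → ℝ} {I : Set ℝ} {x : Fin (n + 1) → ℝ} {r : ℝ}

/-- The flow of the radial field, for `ε = 0` or `ε = 1`. -/
def radialFlow (ε : ℝ) (v : Fin (n + 1) → ℝ) (t : ℝ) (x : Fin (n + 1) → ℝ) : Fin (n + 1) → ℝ :=
  (1 - ε) • (Real.exp t • (x - v) + v) + ε • (x + t • v)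

theorem radialFlow_zero (ε : ℝ) (v x : Fin (n + 1) → ℝ) : radialFlow ε v 0 x = x := by
  simp [radialFlow, ← add_smul]

theorem hasDerivAt_radialFlow (ε : ℝ) (v x : Fin (n + 1) → ℝ) :
    HasDerivAt (fun t => radialFlow ε v t x) (radial ε v x) 0 := by
  have h1 := ((((Real.hasDerivAt_exp 0).smul_const (x - v)).add_const v).fun_const_smul
    (1 - ε)).fun_add ((((hasDerivAt_id (0 : ℝ)).smul_const v).const_add x).fun_const_smul ε)
  simpa [radial, radialFlow] using h1

theorem hasFDerivAt_radialFlow (ε : ℝ) (v x : Fin (n + 1) → ℝ) (t : ℝ) :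
    HasFDerivAt (radialFlow ε v t)
      (((1 - ε) * Real.exp t + ε) • ContinuousLinearMap.id ℝ (Fin (n + 1) → ℝ)) x := by
  have hid := hasFDerivAt_id (𝕜 := ℝ) x
  have h1 := ((((hid.sub_const v).fun_const_smul (Real.exp t)).add_const
    v).fun_const_smul (1 - ε)).fun_add ((hid.add_const (t • v)).fun_const_smul ε)
  refine h1.congr_fderiv ?_
  rw [smul_smul, ← add_smul]

theorem IsAffinelyHomogeneous.isEulerRegular (hF : IsAffinelyHomogeneous lam ε α Ω v F)
    (hΩ : IsOpen Ω) (hI : IsOpen I) (hreg : ∀ r ∈ I, lam * r + α ≠ 0) :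
    IsEulerRegular lam ε α Ω v F I := by
  have hopen : IsOpen (Ω ∩ F ⁻¹' I) := hF.continuousOn.isOpen_inter_preimage hΩ hI
  have hsmooth : ∀ x ∈ Ω ∩ F ⁻¹' I, ContDiffAt ℝ ∞ F x := by
    intro x hx
    refine (hF.smoothOn.mono ?_).contDiffAt (hopen.mem_nhds hx)
    rintro y ⟨hyΩ, hyI⟩
    refine ⟨hyΩ, ?_⟩
    rintro ⟨hlam, hy⟩
    refine hreg _ hyI ?_
    rw [hy]
    field_simp
    ring
  refine ⟨hΩ, hopen, hsmooth, ?_, hreg⟩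
  intro x hx
  have hγ := hasDerivAt_radialFlow ε v x
  have hd : HasFDerivAt F (fderiv ℝ F x) (radialFlow ε v 0 x) := by
    rw [radialFlow_zero]
    exact ((hsmooth x hx).differentiableAt (by simp)).hasFDerivAt
  have h1 := hd.comp_hasDerivAt (0 : ℝ) hγ
  have h2 : HasDerivAt (fun t => Real.exp (lam * t) * F x + α * t) (lam * F x + α) 0 := by
    have h3 : HasDerivAt (fun t : ℝ => Real.exp (lam * t)) lam 0 := by
      simpa using ((hasDerivAt_id (0 : ℝ)).const_mul lam).exp
    simpa using (h3.mul_const (F x)).fun_add ((hasDerivAt_id (0 : ℝ)).const_mul α)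
  have hev : (F ∘ fun t => radialFlow ε v t x) =ᶠ[𝓝 0]
      fun t => Real.exp (lam * t) * F x + α * t := by
    have : ∀ᶠ t in 𝓝 (0 : ℝ), radialFlow ε v t x ∈ Ω :=
      hγ.continuousAt.eventually_mem (hΩ.mem_nhds (by rw [radialFlow_zero]; exact hx.1))
    filter_upwards [this] with t ht using hF.homogeneous t x hx.1 ht
  exact (h1.congr_of_eventuallyEq hev.symm).unique h2

/-- The Hessian determinant of an affinely homogeneous function is homogeneous. -/
theorem IsAffinelyHomogeneous.hessDet_radialFlow (hF : IsAffinelyHomogeneous lam ε α Ω v F)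
    (hE : IsEulerRegular lam ε α Ω v F I) {t : ℝ} (hx : x ∈ Ω ∩ F ⁻¹' I)
    (hxt : radialFlow ε v t x ∈ Ω ∩ F ⁻¹' I) :
    (((1 - ε) * Real.exp t + ε) ^ 2) ^ (n + 1) * hessDet F (radialFlow ε v t x) =
      Real.exp (lam * t) ^ (n + 1) * hessDet F x := by
  set a := (1 - ε) * Real.exp t + ε with ha
  have hΦ := hasFDerivAt_radialFlow ε v x t
  have hN : ∀ᶠ y in 𝓝 x, y ∈ Ω ∩ F ⁻¹' I ∧ radialFlow ε v t y ∈ Ω ∩ F ⁻¹' I :=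
    (hE.isOpen_preimage.eventually_mem hx).and
      (hΦ.continuousAt.eventually_mem (hE.isOpen_preimage.mem_nhds hxt))
  have h1 : ∀ᶠ y in 𝓝 x, a • fderiv ℝ F (radialFlow ε v t y) =
      Real.exp (lam * t) • fderiv ℝ F y := by
    filter_upwards [hN.eventually_nhds] with y hy
    have hyN := hy.self_of_nhds
    have hl := (hE.differentiableAt hyN.2).hasFDerivAt.comp y (hasFDerivAt_radialFlow ε v y t)
    have hr := ((hE.differentiableAt hyN.1).hasFDerivAt.const_mul
      (Real.exp (lam * t))).add_const (α * t)
    have hev : F ∘ radialFlow ε v t =ᶠ[𝓝 y] fun z => Real.exp (lam * t) * F z + α * t := by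
      filter_upwards [hy] with z hz using hF.homogeneous t z hz.1.1 hz.2.1
    have := (hl.congr_of_eventuallyEq hev.symm).unique hr
    rw [← this]
    ext X
    simp [ha]
  -- The flow map is affine with linear part `a • id`, so each differentiation of the homogeneity
  -- relation contributes one factor `a`.
  have h2 : a ^ 2 • hess F (radialFlow ε v t x) = Real.exp (lam * t) • hess F x := by
    have hl := (((hE.differentiableAt_fderiv hxt).hasFDerivAt.comp x hΦ).const_smul a)
    have hr := (hE.differentiableAt_fderiv hx).hasFDerivAt.const_smul (Real.exp (lam * t))
    have := hl.unique (hr.congr_of_eventuallyEq h1)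
    ext i j
    have hij := congrArg (fun L => L (Pi.single i 1) (Pi.single j 1)) this
    simp at hij
    simp only [Matrix.smul_apply, hess, Matrix.of_apply, smul_eq_mul]
    rw [← hij]
    ring
  have h3 := congrArg Matrix.det h2
  rwa [Matrix.det_smul, Matrix.det_smul, Fintype.card_fin] at h3

/-- A function of `F` that scales like a given weight along the flow is a multiple of the weight. -/
theorem IsAffinelyHomogeneous.exists_eq_mul (hF : IsAffinelyHomogeneous lam ε α Ω v F)
    (hE : IsEulerRegular lam ε α Ω v F I) {φ w : ℝ → ℝ} (hφ0 : ∀ r ∈ I, φ r ≠ 0)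
    (hφ : ∀ x ∈ Ω ∩ F ⁻¹' I, hessDet F x = φ (F x))
    (hconn : IsPreconnected (F '' (Ω ∩ F ⁻¹' I))) (hw0 : ∀ r ∈ I, w r ≠ 0)
    (hw : ∀ r ∈ I, ∀ t, (((1 - ε) * Real.exp t + ε) ^ 2) ^ (n + 1) *
      w (Real.exp (lam * t) * r + α * t) = Real.exp (lam * t) ^ (n + 1) * w r) :
    ∃ B : ℝ, B ≠ 0 ∧ ∀ r ∈ F '' (Ω ∩ F ⁻¹' I), φ r = B * w r := by
  have hloc : ∀ r ∈ F '' (Ω ∩ F ⁻¹' I), ∀ᶠ s in 𝓝 r, φ s / w s = φ r / w r := by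
    rintro _ ⟨x, hx, rfl⟩
    have hr := hE.regular _ hx.2
    have hρ : HasStrictDerivAt (fun t => Real.exp (lam * t) * F x + α * t) (lam * F x + α) 0 := by
      have h3 : HasStrictDerivAt (fun t : ℝ => Real.exp (lam * t)) lam 0 := by
        simpa using ((hasStrictDerivAt_id (0 : ℝ)).const_mul lam).exp
      simpa using (h3.mul_const (F x)).fun_add ((hasStrictDerivAt_id (0 : ℝ)).const_mul α)
    -- The curve of values has nonzero velocity `lam * F x + α` at `t = 0`, so every value near `F
    -- x` is attained along the flow at a small time.
    have hmap := hρ.map_nhds_eq hr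
    simp only [mul_zero, Real.exp_zero, one_mul, add_zero] at hmap
    rw [← hmap, Filter.eventually_map]
    have hflow : ∀ᶠ t in 𝓝 (0 : ℝ), radialFlow ε v t x ∈ Ω ∩ F ⁻¹' I :=
      (hasDerivAt_radialFlow ε v x).continuousAt.eventually_mem
        (hE.isOpen_preimage.mem_nhds (by rw [radialFlow_zero]; exact hx))
    have hcont : ContinuousAt (fun t : ℝ => (1 - ε) * Real.exp t + ε) 0 := by fun_prop
    have hpos : ∀ᶠ t in 𝓝 (0 : ℝ), (1 - ε) * Real.exp t + ε ≠ 0 :=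
      hcont.eventually_ne (by simp)
    filter_upwards [hflow, hpos] with t ht ha
    have hFt : F (radialFlow ε v t x) = Real.exp (lam * t) * F x + α * t :=
      hF.homogeneous t x hx.1 ht.1
    have h1 := hF.hessDet_radialFlow hE hx ht
    rw [hφ _ ht, hφ _ hx, hFt] at h1
    have h2 := hw _ hx.2 t
    have hI' : Real.exp (lam * t) * F x + α * t ∈ I := hFt ▸ ht.2
    rw [div_eq_div_iff (hw0 _ hI') (hw0 _ hx.2)]
    have ha' : (((1 - ε) * Real.exp t + ε) ^ 2) ^ (n + 1) ≠ 0 := by positivity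
    refine mul_left_cancel₀ ha' ?_
    linear_combination w (F x) * h1 - φ (F x) * h2
  rcases (F '' (Ω ∩ F ⁻¹' I)).eq_empty_or_nonempty with hempty | ⟨r₀, hr₀⟩
  -- With no values attained, any nonzero constant serves.
  · exact ⟨1, one_ne_zero, by simp [hempty]⟩
  have hsub : F '' (Ω ∩ F ⁻¹' I) ⊆ I := by
    rintro _ ⟨x, hx, rfl⟩
    exact hx.2
  have : PreconnectedSpace (F '' (Ω ∩ F ⁻¹' I)) := Subtype.preconnectedSpace hconn
  have hlc : IsLocallyConstant fun r : F '' (Ω ∩ F ⁻¹' I) => φ r / w r :=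
    (IsLocallyConstant.iff_eventually_eq _).2 fun r =>
      continuous_subtype_val.continuousAt.eventually (hloc r r.2)
  refine ⟨φ r₀ / w r₀, div_ne_zero (hφ0 _ (hsub hr₀)) (hw0 _ (hsub hr₀)), fun r hr => ?_⟩
  have := hlc.apply_eq_of_preconnectedSpace ⟨r, hr⟩ ⟨r₀, hr₀⟩
  rw [← this]
  exact (div_mul_cancel₀ _ (hw0 _ (hsub hr))).symm

/-! ### Affine mean curvature of the level sets -/

/-- The affine mean curvature of a level set with Hessian determinant `p`, `λ - (1 - ε) = μ` and
`dF(E) = d`, for `ε = 0`. -/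
def levelCurvature (n : ℕ) (μ d p : ℝ) : ℝ :=
  Real.sign d * |μ| ^ (-1 / ((n : ℝ) + 2)) * |d| ^ (-((n : ℝ) + 1) / ((n : ℝ) + 2)) *
    |p| ^ (1 / ((n : ℝ) + 2))

theorem levelCurvature_mul_pos {μ d p : ℝ} (hμ : μ ≠ 0) (hd : d ≠ 0) (hp : p ≠ 0) :
    0 < levelCurvature n μ d p * d := by
  unfold levelCurvature
  have h1 : 0 < Real.sign d * d := by
    rcases lt_or_gt_of_ne hd with h | h
    · rw [Real.sign_of_neg h]; linarith
    · rw [Real.sign_of_pos h]; linarith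
  have h2 : 0 < |μ| ^ (-1 / ((n : ℝ) + 2)) * |d| ^ (-((n : ℝ) + 1) / ((n : ℝ) + 2)) *
    |p| ^ (1 / ((n : ℝ) + 2)) := by positivity
  nlinarith [mul_pos h1 h2]

/-- This is the volume condition for the normal `k E` with `k = -levelCurvature n μ d p`; the
exponents in `levelCurvature` come from solving it for `|k|`. -/
theorem abs_levelCurvature_pow {μ d p : ℝ} (hμ : μ ≠ 0) (hd : d ≠ 0) :
    |levelCurvature n μ d p| ^ (n + 2) * |μ| * |d| ^ (n + 1) = |p| := by
  have hn : (n : ℝ) + 2 ≠ 0 := by positivity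
  have hpow : ∀ y s : ℝ, 0 ≤ y → (y ^ (s / ((n : ℝ) + 2))) ^ (n + 2) = y ^ s := by
    intro y s hy
    rw [← Real.rpow_natCast, ← Real.rpow_mul hy]
    push_cast
    rw [div_mul_cancel₀ _ hn]
  have hs : |Real.sign d| = 1 := by
    rcases Real.sign_apply_eq_of_ne_zero d hd with h | h <;> simp [h]
  unfold levelCurvature
  rw [abs_mul, abs_mul, abs_mul, hs, one_mul, Real.abs_rpow_of_nonneg (abs_nonneg _),
    Real.abs_rpow_of_nonneg (abs_nonneg _), Real.abs_rpow_of_nonneg (abs_nonneg _), abs_abs,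
    abs_abs, abs_abs, mul_pow, mul_pow, hpow _ _ (abs_nonneg _), hpow _ _ (abs_nonneg _),
    hpow _ _ (abs_nonneg _), Real.rpow_one, Real.rpow_neg_one, Real.rpow_neg (abs_nonneg _)]
  have h1 : |d| ^ ((n : ℝ) + 1) = |d| ^ (n + 1) := by
    rw [← Real.rpow_natCast]
    push_cast
    rfl
  rw [h1]
  have hd' := abs_pos.2 hd
  have hμ' := abs_pos.2 hμ
  field_simp

namespace IsEulerRegular

/-- The sign of `d` built into `levelCurvature` gives `k * d < 0` for `k = -levelCurvature …`, the
side required by the co-orientation. The signatures agree because the Hessian determinant has the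
same value `p` throughout. -/
theorem exists_isEquiaffine (hF : IsEulerRegular lam ε α Ω v F I) (hn : 1 ≤ n) (hr : r ∈ I)
    (hμ : lam - (1 - ε) ≠ 0) {p : ℝ} (hp : p ≠ 0)
    (hH : ∀ x ∈ {y ∈ Ω | F y = r}, hessDet F x = p) :
    ∃ h S, IsEquiaffine {y ∈ Ω | F y = r} (stdCoorient F)
        (fun x => (-levelCurvature n (lam - (1 - ε)) (lam * r + α) p) • radial ε v x) h S ∧
      HasMeanCurvature {y ∈ Ω | F y = r} S
        ((1 - ε) * levelCurvature n (lam - (1 - ε)) (lam * r + α) p) ∧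
      ∀ x ∈ {y ∈ Ω | F y = r}, ∀ y ∈ {y ∈ Ω | F y = r},
        signature (h x) ≡ signature (h y) [ZMOD 4] := by
  have hd := hF.regular r hr
  set A := levelCurvature n (lam - (1 - ε)) (lam * r + α) p with hA
  have hAd : 0 < A * (lam * r + α) := levelCurvature_mul_pos hμ hd hp
  have hk : -A * (lam * r + α) < 0 := by linarith
  refine ⟨_, _, hF.isEquiaffine_levelSet hr hμ hp hk ?_ hH, ?_, ?_⟩
  · rw [abs_neg]
    exact abs_levelCurvature_pow hμ hd
  · intro x hx
    rw [map_smul, LinearMap.trace_id, hF.finrank_tangent hr hx, smul_eq_mul, mul_div_assoc,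
      div_self (by positivity)]
    ring
  · have hc : -(-A * (lam * r + α)) ≠ 0 := neg_ne_zero.2 hk.ne
    have hsig : ∀ x ∈ {y ∈ Ω | F y = r}, signature ((-(-A * (lam * r + α)))⁻¹ •
        (hessForm F x).restrict (tangent {y ∈ Ω | F y = r} x)) ≡
          n + 1 - (SignType.sign ((-(-A * (lam * r + α))) ^ n *
            ((lam - (1 - ε)) * (lam * r + α))) : ℤ) * (SignType.sign p : ℤ) [ZMOD 4] := by
      intro x hx
      have := hF.signature_metric_modEq hr hμ hx hc
        (h := (-(-A * (lam * r + α)))⁻¹ • (hessForm F x).restrict (tangent {y ∈ Ω | F y = r} x))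
        (fun X Y => by
          simp only [LinearMap.smul_apply, LinearMap.BilinForm.restrict_apply, smul_eq_mul]
          rw [mul_inv_cancel_left₀ hc]
          rfl) (by rw [hH x hx]; exact hp)
      rwa [hH x hx] at this
    exact fun x hx y hy => (hsig x hx).trans (hsig y hy).symm

theorem hasAffineMeanCurvature (hF : IsEulerRegular lam ε α Ω v F I) (hn : 1 ≤ n) (hr : r ∈ I)
    (hμ : lam - (1 - ε) ≠ 0) {p : ℝ} (hp : p ≠ 0)
    (hH : ∀ x ∈ {y ∈ Ω | F y = r}, hessDet F x = p) :
    HasAffineMeanCurvature {y ∈ Ω | F y = r} (stdCoorient F)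
      ((1 - ε) * levelCurvature n (lam - (1 - ε)) (lam * r + α) p) := by
  obtain ⟨h, S, h1, h2, -⟩ := hF.exists_isEquiaffine hn hr hμ hp hH
  exact ⟨_, h, S, h1, h2⟩

theorem isProperAffineSphere (hF : IsEulerRegular lam 0 α Ω v F I) (hn : 1 ≤ n) (hr : r ∈ I)
    (hμ : lam - (1 - 0) ≠ 0) {p : ℝ} (hp : p ≠ 0)
    (hH : ∀ x ∈ {y ∈ Ω | F y = r}, hessDet F x = p) :
    IsProperAffineSphere {y ∈ Ω | F y = r} (stdCoorient F) v := by
  obtain ⟨h, S, h1, h2, h3⟩ := hF.exists_isEquiaffine hn hr hμ hp hH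
  set A := levelCurvature n (lam - (1 - 0)) (lam * r + α) p
  have hA : A ≠ 0 := left_ne_zero_of_mul (levelCurvature_mul_pos hμ (hF.regular r hr) hp).ne'
  -- From `ξ = -A (x - v)` one gets `v = x + A⁻¹ ξ`.
  refine ⟨_, h, S, h1, fun x _ => ⟨A⁻¹, ?_⟩, ⟨A, hA, by simpa using h2⟩, h3⟩
  rw [smul_smul, mul_neg, inv_mul_cancel₀ hA]
  simp [radial]

theorem isImproperAffineSphere (hF : IsEulerRegular lam 1 α Ω v F I) (hn : 1 ≤ n) (hr : r ∈ I)
    (hμ : lam - (1 - 1) ≠ 0) {p : ℝ} (hp : p ≠ 0)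
    (hH : ∀ x ∈ {y ∈ Ω | F y = r}, hessDet F x = p) :
    IsImproperAffineSphere {y ∈ Ω | F y = r} (stdCoorient F) v := by
  obtain ⟨h, S, h1, h2, h3⟩ := hF.exists_isEquiaffine hn hr hμ hp hH
  exact ⟨_, h, S, h1, ⟨-levelCurvature n (lam - (1 - 1)) (lam * r + α) p,
    fun x _ => by simp [radial]⟩, by simpa using h2, h3⟩

end IsEulerRegular

/-- The common value on each level defines `φ`; empty levels receive the value 1 to keep `φ`
nonvanishing. -/
theorem exists_comp_eq_of_constant_on_levels {V : Type*} {Ω : Set V} {F H : V → ℝ} {I : Set ℝ}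
    (hH : ∀ r ∈ I, (∀ x ∈ {y ∈ Ω | F y = r}, H x ≠ 0) ∧
      ∀ x ∈ {y ∈ Ω | F y = r}, ∀ y ∈ {y ∈ Ω | F y = r}, H x = H y) :
    ∃ φ : ℝ → ℝ, (∀ r ∈ I, φ r ≠ 0) ∧ ∀ x ∈ Ω ∩ F ⁻¹' I, H x = φ (F x) := by
  classical
  refine ⟨fun r => if h : {y ∈ Ω | F y = r}.Nonempty then H h.some else 1, ?_, ?_⟩
  · intro r hr
    dsimp only
    split_ifs with h
    · exact (hH r hr).1 _ h.some_mem
    · exact one_ne_zero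
  · rintro x ⟨hx, hxI⟩
    have h : {y ∈ Ω | F y = F x}.Nonempty := ⟨x, hx, rfl⟩
    dsimp only
    rw [dif_pos h]
    exact (hH (F x) hxI).2 x ⟨hx, rfl⟩ _ h.some_mem

/-! ### Explicit weights and curvature formulas -/

/-- The exponent `s` is the solution of `2(n + 1) + lam * s = (n + 1) * lam`, obtained by comparing
powers of `exp t`. -/
theorem weight_scaling_power (n : ℕ) {lam : ℝ} (hlam : lam ≠ 0) (r t : ℝ) :
    (Real.exp t ^ 2) ^ (n + 1) *
        |Real.exp (lam * t) * r| ^ (((n : ℝ) + 1) * (lam - 2) / lam) =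
      Real.exp (lam * t) ^ (n + 1) * |r| ^ (((n : ℝ) + 1) * (lam - 2) / lam) := by
  rw [abs_mul, Real.mul_rpow (abs_nonneg _) (abs_nonneg _), Real.abs_exp, ← Real.exp_mul,
    ← mul_assoc, ← Real.exp_nat_mul, ← Real.exp_nat_mul, ← Real.exp_nat_mul, ← Real.exp_add]
  congr 2
  push_cast
  field_simp
  ring

/-- For `lam = 0` the flow shifts values by `α t`, and the weight must absorb the factor `exp (2(n +
1)t)`. -/
theorem weight_scaling_exp (n : ℕ) {α : ℝ} (hα : α ≠ 0) (r t : ℝ) :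
    (Real.exp t ^ 2) ^ (n + 1) * Real.exp (-2 * ((n : ℝ) + 1) * (r + α * t) / α) =
      Real.exp (-2 * ((n : ℝ) + 1) * r / α) := by
  rw [← Real.exp_nat_mul, ← Real.exp_nat_mul, ← Real.exp_add]
  congr 1
  push_cast
  field_simp
  ring

theorem levelCurvature_power (n : ℕ) {lam r : ℝ} (hr : r ≠ 0) (B μ : ℝ) :
    levelCurvature n μ (lam * r) (B * |r| ^ (((n : ℝ) + 1) * (lam - 2) / lam)) =
      Real.sign (lam * r) * |μ| ^ (-1 / ((n : ℝ) + 2)) *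
        |lam| ^ (-((n : ℝ) + 1) / ((n : ℝ) + 2)) * |B| ^ (1 / ((n : ℝ) + 2)) *
        |r| ^ (((n : ℝ) + 1) * (lam - 2) / (((n : ℝ) + 2) * lam) -
          ((n : ℝ) + 1) / ((n : ℝ) + 2)) := by
  have hr' : 0 < |r| := abs_pos.2 hr
  unfold levelCurvature
  rw [abs_mul lam, abs_mul B, Real.mul_rpow (abs_nonneg _) (abs_nonneg _),
    Real.mul_rpow (abs_nonneg _) (abs_nonneg _), Real.abs_rpow_of_nonneg (abs_nonneg _), abs_abs,
    ← Real.rpow_mul (abs_nonneg _),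
    sub_eq_add_neg (_ / _), Real.rpow_add hr', ← neg_div ((n : ℝ) + 2)]
  have : ((n : ℝ) + 1) * (lam - 2) / lam * (1 / ((n : ℝ) + 2)) =
      ((n : ℝ) + 1) * (lam - 2) / (((n : ℝ) + 2) * lam) := by
    rw [div_mul_div_comm, mul_one, mul_comm lam]
  rw [this]
  ring

theorem levelCurvature_exp (n : ℕ) (α B r : ℝ) :
    levelCurvature n (-1) α (B * Real.exp (-2 * ((n : ℝ) + 1) * r / α)) =
      Real.sign α * |α| ^ (-((n : ℝ) + 1) / ((n : ℝ) + 2)) * |B| ^ (1 / ((n : ℝ) + 2)) *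
        Real.exp (-2 * ((n : ℝ) + 1) * r / (α * ((n : ℝ) + 2))) := by
  unfold levelCurvature
  rw [abs_neg, abs_one, Real.one_rpow, abs_mul B, Real.mul_rpow (abs_nonneg _) (abs_nonneg _),
    Real.abs_exp, ← Real.exp_mul, div_mul_div_comm, mul_one, mul_one]
  ring

end AffineSphere

end

/-! ### The main theorem -/

theorem theorem1 (n : ℕ) (hn : 1 ≤ n) (lam ε α : ℝ) (hε : ε = 0 ∨ ε = 1)
    (hne : ¬ (α = 0 ∧ lam = 0)) (hαlam : α * lam = 0) (hαε : α * ε = 0) (hlam : lam ≠ 1 - ε)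
    (Ω : Set (Fin (n + 1) → ℝ)) (hΩ : IsOpen Ω) (hΩne : Ω.Nonempty)
    (I : Set ℝ) (hI : IsOpen I) (hIconn : IsConnected I) (hIreg : ∀ r ∈ I, lam * r + α ≠ 0)
    (v : Fin (n + 1) → ℝ) (F : (Fin (n + 1) → ℝ) → ℝ)
    (hF : AffineSphere.IsAffinelyHomogeneous lam ε α Ω v F) :
    ((∃ φ : ℝ → ℝ, (∀ r ∈ I, φ r ≠ 0) ∧
        ∀ x ∈ Ω ∩ F ⁻¹' I, AffineSphere.hessDet F x = φ (F x)) ↔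
      (∃ ψ : ℝ → ℝ, (∀ r ∈ I, ψ r ≠ 0) ∧
        ∀ x ∈ Ω ∩ F ⁻¹' I, AffineSphere.adjQuad F x = ψ (F x))) ∧
    (ε = 0 →
      ((∃ φ : ℝ → ℝ, (∀ r ∈ I, φ r ≠ 0) ∧
          ∀ x ∈ Ω ∩ F ⁻¹' I, AffineSphere.hessDet F x = φ (F x)) ↔
        ∀ r ∈ I, AffineSphere.IsProperAffineSphere {x ∈ Ω | F x = r}
          (AffineSphere.stdCoorient F) v)) ∧
    (ε = 1 →
      ((∃ φ : ℝ → ℝ, (∀ r ∈ I, φ r ≠ 0) ∧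
          ∀ x ∈ Ω ∩ F ⁻¹' I, AffineSphere.hessDet F x = φ (F x)) ↔
        ∀ r ∈ I, AffineSphere.IsImproperAffineSphere {x ∈ Ω | F x = r}
          (AffineSphere.stdCoorient F) v)) ∧
    (∀ φ ψ : ℝ → ℝ, (∀ r ∈ I, φ r ≠ 0) → (∀ r ∈ I, ψ r ≠ 0) →
      (∀ x ∈ Ω ∩ F ⁻¹' I, AffineSphere.hessDet F x = φ (F x)) →
      (∀ x ∈ Ω ∩ F ⁻¹' I, AffineSphere.adjQuad F x = ψ (F x)) →
      IsPreconnected (F '' (Ω ∩ F ⁻¹' I)) →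
      ∃ B : ℝ, B ≠ 0 ∧ ∀ r ∈ F '' (Ω ∩ F ⁻¹' I),
        (α = 0 → ε = 0 →
          φ r = B * |r| ^ (((n : ℝ) + 1) * (lam - 2) / lam) ∧
          ψ r = lam / (lam - 1) * r * φ r ∧
          AffineSphere.HasAffineMeanCurvature {x ∈ Ω | F x = r} (AffineSphere.stdCoorient F)
            (Real.sign (lam * r) * |lam - 1| ^ (-1 / ((n : ℝ) + 2)) *
              |lam| ^ (-((n : ℝ) + 1) / ((n : ℝ) + 2)) * |B| ^ (1 / ((n : ℝ) + 2)) *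
              |r| ^ (((n : ℝ) + 1) * (lam - 2) / (((n : ℝ) + 2) * lam) -
                ((n : ℝ) + 1) / ((n : ℝ) + 2)))) ∧
        (lam = 0 → ε = 0 →
          φ r = B * Real.exp (-2 * ((n : ℝ) + 1) * r / α) ∧
          ψ r = -α * φ r ∧
          AffineSphere.HasAffineMeanCurvature {x ∈ Ω | F x = r} (AffineSphere.stdCoorient F)
            (Real.sign α * |α| ^ (-((n : ℝ) + 1) / ((n : ℝ) + 2)) *
              |B| ^ (1 / ((n : ℝ) + 2)) *
              Real.exp (-2 * ((n : ℝ) + 1) * r / (α * ((n : ℝ) + 2))))) ∧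
        (α = 0 → ε = 1 →
          φ r = B * r ^ (n + 1) ∧
          ψ r = r * φ r ∧
          AffineSphere.HasAffineMeanCurvature {x ∈ Ω | F x = r} (AffineSphere.stdCoorient F)
            0)) := by

  have hE := hF.isEulerRegular hΩ hI hIreg
  have hμ : lam - (1 - ε) ≠ 0 := sub_ne_zero.2 hlam
  have hlevel : ∀ φ : ℝ → ℝ, (∀ x ∈ Ω ∩ F ⁻¹' I, AffineSphere.hessDet F x = φ (F x)) →
      ∀ r ∈ I, ∀ x ∈ {y ∈ Ω | F y = r}, AffineSphere.hessDet F x = φ r := by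
    rintro φ hφ r hr x ⟨hx, rfl⟩
    exact hφ x ⟨hx, hr⟩
  refine ⟨⟨?_, ?_⟩, ?_, ?_, ?_⟩
  · rintro ⟨φ, hφ0, hφ⟩
    refine ⟨fun r => (lam * r + α) / (lam - (1 - ε)) * φ r,
      fun r hr => mul_ne_zero (div_ne_zero (hIreg r hr) hμ) (hφ0 r hr), fun x hx => ?_⟩
    have h := hE.mul_adjQuad hx
    beta_reduce
    rw [← hφ x hx, div_mul_eq_mul_div, eq_div_iff hμ, ← h, mul_comm]
  · rintro ⟨ψ, hψ0, hψ⟩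
    refine ⟨fun r => (lam - (1 - ε)) / (lam * r + α) * ψ r,
      fun r hr => mul_ne_zero (div_ne_zero hμ (hIreg r hr)) (hψ0 r hr), fun x hx => ?_⟩
    have h := hE.mul_adjQuad hx
    beta_reduce
    rw [← hψ x hx, div_mul_eq_mul_div, eq_div_iff (hIreg _ hx.2), h, mul_comm]
  · rintro rfl
    refine ⟨?_, fun h => ?_⟩
    · rintro ⟨φ, hφ0, hφ⟩ r hr
      exact hE.isProperAffineSphere hn hr hμ (hφ0 r hr) (hlevel φ hφ r hr)
    · refine AffineSphere.exists_comp_eq_of_constant_on_levels fun r hr => ?_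
      obtain ⟨ξ, g, S, hM, hv, ⟨A, -, hA⟩, hsig⟩ := h r hr
      exact hE.hessDet_eq_of_isEquiaffine hr hμ hM
          (hE.normal_eq_of_isEquiaffine hn hr hM hv hA) hsig
  · rintro rfl
    refine ⟨?_, fun h => ?_⟩
    · rintro ⟨φ, hφ0, hφ⟩ r hr
      exact hE.isImproperAffineSphere hn hr hμ (hφ0 r hr) (hlevel φ hφ r hr)
    · refine AffineSphere.exists_comp_eq_of_constant_on_levels fun r hr => ?_
      obtain ⟨ξ, g, S, hM, ⟨c, hc⟩, -, hsig⟩ := h r hr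
      -- For `ε = 1` the radial field is the constant `v`, so the factor `k` is `c` itself.
      exact hE.hessDet_eq_of_isEquiaffine hr hμ hM (k := c)
          (fun x hx => by rw [hc x hx]; simp [AffineSphere.radial]) hsig
  · intro φ ψ hφ0 hψ0 hφ hψ hconn
    have hsub : ∀ r ∈ F '' (Ω ∩ F ⁻¹' I), r ∈ I := by
      rintro _ ⟨x, hx, rfl⟩
      exact hx.2
    have hψφ : ∀ r ∈ F '' (Ω ∩ F ⁻¹' I), (lam - (1 - ε)) * ψ r = (lam * r + α) * φ r := by
      rintro _ ⟨x, hx, rfl⟩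
      rw [← hφ x hx, ← hψ x hx]
      exact hE.mul_adjQuad hx
    have hcurv : ∀ r ∈ F '' (Ω ∩ F ⁻¹' I), _ := fun r hr =>
      hE.hasAffineMeanCurvature hn (hsub r hr) hμ (hφ0 r (hsub r hr)) (hlevel φ hφ r (hsub r hr))
    rcases hε with rfl | rfl
    · by_cases hα : α = 0
      · subst hα
        have hlam0 : lam ≠ 0 := fun h => hne ⟨rfl, h⟩
        have hI0 : ∀ r ∈ I, r ≠ 0 := by
          rintro r hr rfl
          exact hIreg 0 hr (by simp)
        obtain ⟨B, hB, hφB⟩ := hF.exists_eq_mul hE hφ0 hφ hconn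
          (w := fun r => |r| ^ (((n : ℝ) + 1) * (lam - 2) / lam))
          (fun r hr => (Real.rpow_pos_of_pos (abs_pos.2 (hI0 r hr)) _).ne')
          (fun r _ t => by
            simpa using AffineSphere.weight_scaling_power n hlam0 r t)
        refine ⟨B, hB, fun r hr => ⟨fun _ _ => ⟨hφB r hr, ?_, ?_⟩, fun h => absurd h hlam0,
          fun _ h => absurd h zero_ne_one⟩⟩
        · have h := hψφ r hr
          have hμ' : lam - 1 ≠ 0 := by simpa using hμ
          rw [sub_zero, add_zero] at h
          field_simp
          linear_combination h
        · have h := hcurv r hr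
          rwa [hφB r hr, sub_zero, one_mul, add_zero,
            AffineSphere.levelCurvature_power n (hI0 r (hsub r hr))] at h
      · have hlam0 : lam = 0 := (mul_eq_zero.1 hαlam).resolve_left hα
        subst hlam0
        obtain ⟨B, hB, hφB⟩ := hF.exists_eq_mul hE hφ0 hφ hconn
          (w := fun r => Real.exp (-2 * ((n : ℝ) + 1) * r / α))
          (fun r _ => (Real.exp_pos _).ne')
          (fun r _ t => by
            simpa using AffineSphere.weight_scaling_exp n hα r t)
        refine ⟨B, hB, fun r hr => ⟨fun h => absurd h hα, fun _ _ => ⟨hφB r hr, ?_, ?_⟩,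
          fun h => absurd h hα⟩⟩
        · linear_combination -hψφ r hr
        · have h := hcurv r hr
          rwa [hφB r hr, sub_zero, one_mul, zero_mul, zero_add, zero_sub,
            AffineSphere.levelCurvature_exp] at h
    · have hα : α = 0 := by simpa using hαε
      subst hα
      have hlam0 : lam ≠ 0 := by simpa using hlam
      have hI0 : ∀ r ∈ I, r ≠ 0 := by
        rintro r hr rfl
        exact hIreg 0 hr (by simp)
      -- For `ε = 1` the flow consists of translations, of linear part the identity, so the weight
      -- need only be homogeneous of degree `n + 1`.
      obtain ⟨B, hB, hφB⟩ := hF.exists_eq_mul hE hφ0 hφ hconn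
        (w := fun r => r ^ (n + 1)) (fun r hr => pow_ne_zero _ (hI0 r hr))
        (fun r _ t => by simp [mul_pow])
      refine ⟨B, hB, fun r hr => ⟨fun _ h => absurd h one_ne_zero, fun h => absurd h hlam0,
        fun _ _ => ⟨hφB r hr, ?_, ?_⟩⟩⟩
      · exact mul_left_cancel₀ hlam0 (by linear_combination hψφ r hr)
      · simpa using hcurv r hr
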